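/- **Model.** Let $d\ge 2$, $\lambda>0$, and let $\pi=(\pi_1,\pi_2)$ be a probability vector. For $i,j\in\{1,2\}$ let $P_{ij}$ be probability laws on $\mathbb R$ with densities $p_{ij}$ with respect to a common $\sigma$-finite measure $m$ (Lebesgue measure, or counting measure on a countable set in the discrete case), with $P_{12}=P_{21}$, $P_{11}\ne P_{12}$ and $P_{21}=P_{22}$. For $n\in\mathbb N$, let $G\sim\mathrm{GHCM}(\lambda,n,\pi,P,d)$: the vertex set $V$ is a homogeneous Poisson point process of intensity $\lambda$ in $\mathcal S_{d,n}=[-n^{1/d}/2,n^{1/d}/2]^d$ with the toroidal metric $\|u-v\|^2=\sum_{l=1}^d\min\{|u_l-v_l|,\,n^{1/d}-|u_l-v_l|\}^2$; every vertex $u$ independently receives a community $x^\star(u)\in\{1,2\}$ with law $\pi$; given this, the observations $Y_{uv}$ on pairs are independent, with $Y_{uv}\sim P_{x^\star(u)x^\star(v)}$ if $\|u-v\|\le(\log n)^{1/d}$ and $Y_{uv}=0$ otherwise. Put $C^\star=\{u\in V: x^\star(u)=1\}$. Let $\nu_d$ be the volume of the Euclidean unit ball of $\mathbb R^d$, $\theta_i=(p_{i1},p_{i2})$,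 and $$D_+(\theta_i,\theta_j)=1-\inf_{t\in[0,1]}\sum_{l=1}^{2}\pi_l\int p_{il}^{\,t}\,p_{jl}^{\,1-t}\,dm .$$ **Visibility graph.** For $\chi,\delta>0$ cut $\mathcal S_{d,n}$ into $m_n^d$ congruent cubes (blocks) of side $n^{1/d}/m_n$, where $m_n=\lceil (n/(\chi\log n))^{1/d}\rceil$; thus the blocks have volume $\chi\log n$ up to the rounding that makes their number an integer. The *$C^\star$-visibility graph* has as vertices the blocks that contain at least $\delta\log n$ vertices of $C^\star$, and two distinct such blocks $B,B'$ are adjacent if $\|x-y\|\le(\log n)^{1/d}$ for all $x\in B$, $y\in B'$. **Proposition.** Let $d\ge2$, $\lambda'>0$, and let $\chi$ satisfy $$1-\tfrac{3\sqrt d\,\chi^{1/d}}{2}>0,\qquad \nu_d\Big(1-\tfrac{3\sqrt d\,\chi^{1/d}}{2}\Big)^d\ \ge\ \tfrac12\Big(\nu_d+\tfrac1{\lambda'}\Big),\qquad 0<\chi<\tfrac12\Big(\nu_d-\tfrac1{\lambda'}\Big).$$ Then there is a constant $\widetilde\delta>0$, depending only on $d,\lambda',\chi$, such that the following holds for every model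 as above with $\pi_1\lambda=\lambda'$ and $$\lambda\,\nu_d\,\min_{i\ne j}D_+(\theta_i,\theta_j)>1 .$$ For every $\delta$ with $0<\delta<\widetilde\delta\chi/(\nu_dR_d)$, where $R_d=1-\sqrt d\,\chi^{1/d}/2$, the probability that the $C^\star$-visibility graph is connected tends to $1$ as $n\to\infty$. -/

import Mathlib

open MeasureTheory ProbabilityTheory Filter Topology
open scoped NNReal ENNReal

noncomputable section

/-! ## The torus and its blocks -/

/-- The side length `n^{1/d}` of the region `[-n^{1/d}/2, n^{1/d}/2]^d`. -/
def sideLength (d n : ℕ) : ℝ := (n : ℝ) ^ (1 / (d : ℝ))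

/-- The region `[-n^{1/d}/2, n^{1/d}/2]^d`, of volume `n`. -/
def region (d n : ℕ) : Set (Fin d → ℝ) :=
  Set.Icc (fun _ => -(sideLength d n) / 2) (fun _ => sideLength d n / 2)

/-- The toroidal metric on the region. -/
def torusDist (d n : ℕ) (u v : Fin d → ℝ) : ℝ :=
  Real.sqrt (∑ l, (min |u l - v l| (sideLength d n - |u l - v l|)) ^ 2)

/-- The visibility radius `(log n)^{1/d}`. -/
def visRadius (d n : ℕ) : ℝ := (Real.log n) ^ (1 / (d : ℝ))

/-- The volume of the Euclidean unit ball of `ℝ^d`. -/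
def unitBallVolume (d : ℕ) : ℝ :=
  (volume (Metric.ball (0 : EuclideanSpace ℝ (Fin d)) 1)).toReal

/-- The number of blocks along each axis: `(n / (χ log n))^{1/d}`, rounded up to an integer. -/
def blocksPerSide (d n : ℕ) (χ : ℝ) : ℕ :=
  ⌈((n : ℝ) / (χ * Real.log n)) ^ (1 / (d : ℝ))⌉₊

/-- The blocks: the region is cut into `m^d` congruent cubes of side `n^{1/d} / m`, with
`m = blocksPerSide d n χ`. The cubes are half-open, since opposite faces of the region are
identified. -/
def block (d n : ℕ) (χ : ℝ) (i : Fin d → Fin (blocksPerSide d n χ)) : Set (Fin d → ℝ) :=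
  {x | ∀ l,
    -(sideLength d n) / 2 + (i l : ℝ) * (sideLength d n / blocksPerSide d n χ) ≤ x l ∧
    x l < -(sideLength d n) / 2 + ((i l : ℝ) + 1) * (sideLength d n / blocksPerSide d n χ)}

/-- Two sets are mutually visible if all their points are within the visibility radius. -/
def MutuallyVisible (d n : ℕ) (A B : Set (Fin d → ℝ)) : Prop :=
  ∀ x ∈ A, ∀ y ∈ B, torusDist d n x y ≤ visRadius d n

theorem torusDist_comm (d n : ℕ) (u v : Fin d → ℝ) : torusDist d n u v = torusDist d n v u := by
  simp only [torusDist, abs_sub_comm]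

theorem MutuallyVisible.symm {d n : ℕ} {A B : Set (Fin d → ℝ)} (h : MutuallyVisible d n A B) :
    MutuallyVisible d n B A := fun x hx y hy => by
  rw [torusDist_comm]
  exact h y hy x hx

/-- The `(χ, δ)`-visibility graph of a point configuration in the region, where `cnt A` is the
number of points of the configuration in `A`: its vertices are the blocks with at least
`δ log n` points, and edges join distinct mutually visible blocks. -/
def visibilityGraph (d n : ℕ) (χ δ : ℝ) (cnt : Set (Fin d → ℝ) → ℕ) :
    SimpleGraph {i : Fin d → Fin (blocksPerSide d n χ) //
      δ * Real.log n ≤ (cnt (block d n χ i) : ℝ)} where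
  Adj i j := i ≠ j ∧ MutuallyVisible d n (block d n χ i.1) (block d n χ j.1)
  symm := ⟨fun _ _ h => ⟨h.1.symm, h.2.symm⟩⟩
  loopless := ⟨fun _ h => h.1 rfl⟩

/-! ## Poisson point processes -/

open Classical in
/-- The number of the points `X 0 ω, …, X (N ω - 1) ω` that lie in `A`. -/
def pointCount {Ω E : Type*} (N : Ω → ℕ) (X : ℕ → Ω → E) (A : Set E) (ω : Ω) : ℕ :=
  ((Finset.range (N ω)).filter (fun k => X k ω ∈ A)).card

/-- The random points `X 0, …, X (N - 1)` form a Poisson point process whose intensity measure is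
the finite measure `Λ`: the number of points in a measurable set `A` has the Poisson law of mean
`Λ A`, and the numbers of points in disjoint measurable sets are independent. -/
structure IsPoissonProcess {Ω E : Type*} [MeasurableSpace Ω] [MeasurableSpace E]
    (μ : Measure Ω) (Λ : Measure E) (N : Ω → ℕ) (X : ℕ → Ω → E) : Prop where
  finite : Λ Set.univ ≠ ∞
  measurable_number : Measurable N
  measurable_point : ∀ k, Measurable (X k)
  count_law : ∀ A : Set E, MeasurableSet A →
    μ.map (pointCount N X A) = poissonMeasure (Λ A).toNNReal
  count_indep : ∀ (r : ℕ) (A : Fin r → Set E), (∀ j, MeasurableSet (A j)) →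
    Pairwise (fun i j => Disjoint (A i) (A j)) →
    iIndepFun (fun j => pointCount N X (A j)) μ

/-! ## The geometric hidden community model -/

/-- The parameters `λ`, `π`, `P` of the model with communities `Fin k`. The observation law
`P i j` is given by its density `dens i j` with respect to a common σ-finite measure `ref`
(Lebesgue measure for densities, counting measure on a countable set for mass functions). -/
structure GHCMParams (k : ℕ) where
  lam : ℝ
  lam_pos : 0 < lam
  prior : Fin k → ℝ
  prior_nonneg : ∀ i, 0 ≤ prior i
  prior_sum : ∑ i, prior i = 1
  ref : Measure ℝ
  ref_sigmaFinite : SigmaFinite ref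
  dens : Fin k → Fin k → ℝ → ℝ
  dens_measurable : ∀ i j, Measurable (dens i j)
  dens_nonneg : ∀ i j y, 0 ≤ dens i j y
  dens_lintegral : ∀ i j, ∫⁻ y, ENNReal.ofReal (dens i j y) ∂ref = 1
  dens_symm : ∀ i j, dens i j =ᵐ[ref] dens j i

/-- The observation law `P i j`. -/
def GHCMParams.obsLaw {k : ℕ} (θ : GHCMParams k) (i j : Fin k) : Measure ℝ :=
  θ.ref.withDensity (fun y => ENNReal.ofReal (θ.dens i j y))

/-- The Chernoff–Hellinger divergence `D₊(p, q)` of two vectors of densities with respect to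
`ref`, with weights `w`. -/
def chDivergence {k : ℕ} (ref : Measure ℝ) (w : Fin k → ℝ) (p q : Fin k → ℝ → ℝ) : ℝ :=
  1 - ⨅ t : Set.Icc (0 : ℝ) 1,
    ∑ i, w i * ∫ y, (p i y) ^ (t : ℝ) * (q i y) ^ (1 - (t : ℝ)) ∂ref

/-- `min_{i ≠ j} D₊(θ_i, θ_j)` with `θ_i = (p_{i1}, …, p_{ik})`. -/
def GHCMParams.minDivergence {k : ℕ} (θ : GHCMParams k) : ℝ :=
  ⨅ ij : {ij : Fin k × Fin k // ij.1 ≠ ij.2},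
    chDivergence θ.ref θ.prior (θ.dens ij.1.1) (θ.dens ij.1.2)

/-- A random labelled graph: the vertices are the indices `0, …, number - 1`; vertex `u` has the
location `loc u` and the community `label u`, and `obs u v` is the observation on the pair `u, v`.
The entries at indices that are not vertices are irrelevant. -/
structure GraphSample (Ω : Type*) (d k : ℕ) where
  number : Ω → ℕ
  loc : ℕ → Ω → (Fin d → ℝ)
  label : ℕ → Ω → Fin k
  obs : ℕ → ℕ → Ω → ℝ

/-- Locations and labels together. -/
def GraphSample.config {Ω : Type*} {d k : ℕ} (G : GraphSample Ω d k) (ω : Ω) :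
    ℕ × (ℕ → (Fin d → ℝ)) × (ℕ → Fin k) :=
  (G.number ω, (fun u => G.loc u ω), (fun u => G.label u ω))

open Classical in
/-- The law of the observation on a pair of vertices, given their locations and labels. -/
def GHCMParams.pairLaw {k : ℕ} (θ : GHCMParams k) (d n : ℕ)
    (x y : Fin d → ℝ) (i j : Fin k) : Measure ℝ :=
  if torusDist d n x y ≤ visRadius d n then θ.obsLaw i j else Measure.dirac 0

/-- `G` is sampled from `GHCM(λ, n, π, P, d)`. -/
structure IsGHCM {Ω : Type*} [MeasurableSpace Ω] {k : ℕ} (μ : Measure Ω) (θ : GHCMParams k)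
    (d n : ℕ) (G : GraphSample Ω d k) : Prop where
  /-- The locations are a Poisson process of intensity `λ` in the region. -/
  loc_poisson : IsPoissonProcess μ
    (ENNReal.ofReal θ.lam • (volume : Measure (Fin d → ℝ)).restrict (region d n)) G.number G.loc
  /-- The labels are independent, with law `π`, and independent of the locations. -/
  label_measurable : ∀ u, Measurable (G.label u)
  label_law : ∀ u i, μ {ω | G.label u ω = i} = ENNReal.ofReal (θ.prior i)
  label_iIndep : iIndepFun G.label μ
  label_indep_loc : IndepFun (fun ω u => G.label u ω)
    (fun ω => (G.number ω, fun u => G.loc u ω)) μ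
  /-- Given locations and labels, the observations on the pairs of vertices are independent and
  have the laws `pairLaw`. -/
  obs_measurable : ∀ u v, Measurable (G.obs u v)
  obs_symm : ∀ u v ω, G.obs u v ω = G.obs v u ω
  obs_law : ∀ F : Finset (ℕ × ℕ), (∀ p ∈ F, p.1 < p.2) →
    ∀ B : ℕ × ℕ → Set ℝ, (∀ p, MeasurableSet (B p)) →
    ∀ S : Set (ℕ × (ℕ → (Fin d → ℝ)) × (ℕ → Fin k)), MeasurableSet S →
      (∀ c ∈ S, ∀ p ∈ F, p.2 < c.1) →
    μ {ω | G.config ω ∈ S ∧ ∀ p ∈ F, G.obs p.1 p.2 ω ∈ B p} =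
      ∫⁻ ω in {ω | G.config ω ∈ S},
        ∏ p ∈ F, θ.pairLaw d n (G.loc p.1 ω) (G.loc p.2 ω) (G.label p.1 ω) (G.label p.2 ω) (B p) ∂μ

open Classical in
/-- The number of vertices of community `i` located in `A`. -/
def GraphSample.communityCount {Ω : Type*} {d k : ℕ} (G : GraphSample Ω d k) (i : Fin k) (ω : Ω)
    (A : Set (Fin d → ℝ)) : ℕ :=
  ((Finset.range (G.number ω)).filter (fun u => G.label u ω = i ∧ G.loc u ω ∈ A)).card

/-- The visibility graph formed by the vertices of `C⋆`, the community `1` of a two-community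
model, which is `0 : Fin 2` here. -/
def GraphSample.cstarVisibilityGraph {Ω : Type*} {d : ℕ} (G : GraphSample Ω d 2) (n : ℕ)
    (χ δ : ℝ) (ω : Ω) :=
  visibilityGraph d n χ δ (G.communityCount 0 ω)

/-- The conditions on `χ`, for the rate `r` (`λ'`). The base of the power in `volume_cond` is the
radius of a ball, hence positive. -/
structure ChiCondition (d : ℕ) (r χ : ℝ) : Prop where
  pos : 0 < χ
  radius_pos : 0 < 1 - 3 * Real.sqrt d * χ ^ (1 / (d : ℝ)) / 2
  volume_cond : (unitBallVolume d + 1 / r) / 2 ≤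
    unitBallVolume d * (1 - 3 * Real.sqrt d * χ ^ (1 / (d : ℝ)) / 2) ^ d
  lt : χ < (unitBallVolume d - 1 / r) / 2

/-- The constant `R_d`. -/
def radiusConst (d : ℕ) (χ : ℝ) : ℝ := 1 - Real.sqrt d * χ ^ (1 / (d : ℝ)) / 2

end

-- Lift the blocks periodically to `ℤ^d`, and let `T` be a finite set of index steps that guarantee
-- mutual visibility. Call a block vacant if it holds fewer than `δ log n` points of `C⋆`. If `C` is
-- a finite component of occupied sites, then `(C + T) \ C` is vacant, and Cauchy–Davenport in the
-- torsion-free group `ℤ^d` gives `|C + T| ≥ |C| + |T| - 1`. So an isolated cluster of any shape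
-- costs at least `K = |T| - 1` vacant sites near it. If every window of fixed radius `L` has fewer
-- than `K` vacant sites, each occupied site therefore reaches a fully occupied hyperplane section
-- of a window (`exists_onFullSlab_reach`), and since `d ≥ 2` all these sections are joined to each
-- other (`OnFullSlab.reach_of_windows`). Disconnection thus forces `K` vacant blocks in one window
-- (`exists_vacant_of_not_connected`).
--
-- By thinning, the `C⋆`-count of `K` given blocks has the Poisson generating function of mean about
-- `λ'χK log n`. If `λ'χK > 1` and `δ` is small, a Chernoff bound gives probability at most
-- `n^{-1-ε}` for large `n`. There are at most `n` windows and boundedly many choices of `K` sites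
-- in each, so the union bound `IsGHCM.not_connected_le` tends to zero. The inequality `λ'χK > 1` is
-- `ChiCondition.one_lt`: the unit cubes around the steps in `T` cover a ball, so `χ|T|` is at least
-- the left side of the volume condition (`unitBallVolume_mul_le`), and the upper bound on `χ` pays
-- for the one step lost in Cauchy–Davenport.

/-! ## Connectivity of lattice configurations with few vacant sites -/

/-- An equivalence relation on the lattice that relates neighbouring sites is total. -/
theorem lattice_rel_total {ι : Type*} [Fintype ι] [DecidableEq ι]
    (r : (ι → ℤ) → (ι → ℤ) → Prop) (hr : Equivalence r)
    (h : ∀ x l, r x (x + Pi.single l 1)) (x y : ι → ℤ) : r x y := by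
  have h1 : ∀ (l : ι) (a : ℤ) (x : ι → ℤ), r x (x + Pi.single l a) := by
    intro l a
    induction a with
    | zero => intro x; simpa using hr.refl x
    | succ a ih =>
      intro x
      have := hr.trans (ih x) (h _ l)
      rwa [add_assoc, ← Pi.single_add] at this
    | pred a ih =>
      intro x
      have h2 := h (x + Pi.single l (-(a : ℤ) - 1)) l
      rw [add_assoc, ← Pi.single_add, sub_add_cancel] at h2
      exact hr.trans (ih x) (hr.symm h2)
  have h2 : ∀ s : Finset ι, r x (x + ∑ l ∈ s, Pi.single l ((y - x) l)) := by
    intro s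
    induction s using Finset.induction_on with
    | empty => simpa using hr.refl x
    | insert l s hl ih =>
      rw [Finset.sum_insert hl, add_comm (Pi.single l _), ← add_assoc]
      exact hr.trans ih (h1 _ _ _)
  have h3 := h2 Finset.univ
  rwa [Finset.univ_sum_single, add_sub_cancel] at h3

/-- A finite set of lattice steps that contains the unit steps and is closed under negation and
under shrinking to a single coordinate. -/
structure IsStepSet {d : ℕ} (T : Finset (Fin d → ℤ)) : Prop where
  zero_mem : 0 ∈ T
  neg_mem : ∀ k ∈ T, -k ∈ T
  unit_mem : ∀ l, Pi.single l 1 ∈ T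
  single_mem : ∀ k ∈ T, ∀ l a, |a| ≤ |k l| → Pi.single l a ∈ T

/-- Two occupied sites that differ by a step in `T`. -/
def LatticeStep {d : ℕ} (T : Finset (Fin d → ℤ)) (occ : Set (Fin d → ℤ)) (x y : Fin d → ℤ) :
    Prop :=
  x ∈ occ ∧ y ∈ occ ∧ y - x ∈ T

/-- Two sites that are joined by a path of occupied sites with steps in `T`. -/
def LatticeReach {d : ℕ} (T : Finset (Fin d → ℤ)) (occ : Set (Fin d → ℤ)) :
    (Fin d → ℤ) → (Fin d → ℤ) → Prop :=
  Relation.ReflTransGen (LatticeStep T occ)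

theorem LatticeReach.equivalence {d : ℕ} {T : Finset (Fin d → ℤ)} (hT : IsStepSet T)
    (occ : Set (Fin d → ℤ)) : Equivalence (LatticeReach T occ) where
  refl _ := Relation.ReflTransGen.refl
  symm := by
    intro x y h
    have hs : Std.Symm (LatticeStep T occ) := ⟨fun a b hab => by
      refine ⟨hab.2.1, hab.1, ?_⟩
      rw [← neg_sub]
      exact hT.neg_mem _ hab.2.2⟩
    exact Relation.ReflTransGen.stdSymm.symm _ _ h
  trans := Relation.ReflTransGen.trans

/-- An occupied box is connected. -/
theorem LatticeReach.of_box {d : ℕ} {T : Finset (Fin d → ℤ)} (hT : IsStepSet T)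
    {occ : Set (Fin d → ℤ)} {a b : Fin d → ℤ} (hab : Set.Icc a b ⊆ occ) {x y : Fin d → ℤ}
    (hx : x ∈ Set.Icc a b) (hy : y ∈ Set.Icc a b) : LatticeReach T occ x y := by
  have hE := LatticeReach.equivalence hT occ
  have hle : a ≤ b := hx.1.trans hx.2
  -- Clamping `x ↦ a ⊔ (b ⊓ x)` retracts the lattice onto the box and turns a unit step into the
  -- same step or into no step.
  have key := lattice_rel_total (fun x y => LatticeReach T occ (a ⊔ (b ⊓ x)) (a ⊔ (b ⊓ y)))
    ⟨fun _ => hE.refl _, fun h => hE.symm h, fun h h' => hE.trans h h'⟩ ?_ x y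
  · simpa [inf_eq_right.2 hx.2, inf_eq_right.2 hy.2, sup_eq_right.2 hx.1,
      sup_eq_right.2 hy.1] using key
  · intro x l
    have hmem : ∀ x, a ⊔ (b ⊓ x) ∈ Set.Icc a b := fun x =>
      ⟨le_sup_left, sup_le hle inf_le_left⟩
    refine Relation.ReflTransGen.single ⟨hab (hmem _), hab (hmem _), ?_⟩
    have hcase : a ⊔ (b ⊓ (x + Pi.single l 1)) - a ⊔ (b ⊓ x) = 0 ∨
        a ⊔ (b ⊓ (x + Pi.single l 1)) - a ⊔ (b ⊓ x) = Pi.single l 1 := by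
      by_cases h : a l ≤ x l ∧ x l < b l
      · right
        ext j
        rcases eq_or_ne j l with rfl | hj
        · simp; omega
        · simp [hj]
      · left
        ext j
        rcases eq_or_ne j l with rfl | hj
        · have := hle j
          simp; omega
        · simp [hj]
    rcases hcase with h | h <;> rw [h]
    exacts [hT.zero_mem, hT.unit_mem l]

-- Vacant sites and full slabs of windows

open Classical in
/-- The vacant sites in the window of radius `L` around `z`. -/
noncomputable def vacantSites {d : ℕ} (occ : Set (Fin d → ℤ)) (L : ℕ) (z : Fin d → ℤ) :
    Finset (Fin d → ℤ) :=
  (Finset.Icc (fun l => z l - L) (fun l => z l + L)).filter (· ∉ occ)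

/-- The site `x` lies in a hyperplane all of whose sites in the window around `z` are occupied. -/
def OnFullSlab {d : ℕ} (occ : Set (Fin d → ℤ)) (L : ℕ) (z x : Fin d → ℤ) (l : Fin d) : Prop :=
  (∀ j, z j - L ≤ x j ∧ x j ≤ z j + L) ∧
    ∀ y : Fin d → ℤ, (∀ j, z j - L ≤ y j ∧ y j ≤ z j + L) → y l = x l → y ∈ occ

section

open scoped Pointwise

variable {d : ℕ} {T : Finset (Fin d → ℤ)} {occ : Set (Fin d → ℤ)} {L K : ℕ}

theorem mem_vacantSites {z y : Fin d → ℤ} :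
    y ∈ vacantSites occ L z ↔ (∀ j, z j - L ≤ y j ∧ y j ≤ z j + L) ∧ y ∉ occ := by
  simp [vacantSites, Pi.le_def, forall_and]

/-- A full slab is an occupied box that is degenerate in direction `l`. -/
theorem OnFullSlab.reach_of_eq (hT : IsStepSet T) {z x y : Fin d → ℤ} {l : Fin d}
    (hx : OnFullSlab occ L z x l) (hy : ∀ j, z j - L ≤ y j ∧ y j ≤ z j + L) (hxy : y l = x l) :
    LatticeReach T occ x y := by
  refine LatticeReach.of_box hT (a := Function.update (fun j => z j - L) l (x l))
    (b := Function.update (fun j => z j + L) l (x l)) ?_ ?_ ?_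
  · intro p hp
    have hp1 := fun j => hp.1 j
    have hp2 := fun j => hp.2 j
    refine hx.2 p (fun j => ?_) ?_
    · rcases eq_or_ne j l with rfl | hj
      · have h1 := hp1 j
        have h2 := hp2 j
        have := hx.1 j
        simp only [Function.update_self] at h1 h2
        omega
      · have h1 := hp1 j
        have h2 := hp2 j
        simp only [Function.update_of_ne hj] at h1 h2
        omega
    · have h1 := hp1 l
      have h2 := hp2 l
      simp only [Function.update_self] at h1 h2
      omega
  all_goals
    constructor <;> intro j <;> rcases eq_or_ne j l with rfl | hj
    · simp [hxy]
    · have := hx.1 j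
      have := hy j
      simp only [Function.update_of_ne hj]
      omega
    · simp [hxy]
    · have := hx.1 j
      have := hy j
      simp only [Function.update_of_ne hj]
      omega

/-- If there are fewer vacant sites than candidate heights, one of the slabs is full. -/
theorem exists_full_height (V : Finset (Fin d → ℤ)) (I : Finset ℤ) (l : Fin d)
    (h : V.card < I.card) : ∃ a ∈ I, ∀ y ∈ V, y l ≠ a := by
  obtain ⟨a, ha, ha'⟩ := Finset.exists_mem_notMem_of_card_lt_card
    (lt_of_le_of_lt (Finset.card_image_le (s := V) (f := fun y => y l)) h)
  exact ⟨a, ha, fun y hy hya => ha' (Finset.mem_image.2 ⟨y, hy, hya⟩)⟩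

theorem onFullSlab_of_forall_vacant {z x : Fin d → ℤ} {l : Fin d}
    (hx : ∀ j, z j - L ≤ x j ∧ x j ≤ z j + L) (h : ∀ y ∈ vacantSites occ L z, y l ≠ x l) :
    OnFullSlab occ L z x l :=
  ⟨hx, fun y hy hyx => by_contra fun hyo => h y (mem_vacantSites.2 ⟨hy, hyo⟩) hyx⟩

/-- Slabs orthogonal to different axes meet: replacing the `l'`-coordinate of `x` by that of `y`
gives a site of both. -/
theorem OnFullSlab.reach_of_ne (hT : IsStepSet T) {z x y : Fin d → ℤ} {l l' : Fin d}
    (hx : OnFullSlab occ L z x l) (hy : OnFullSlab occ L z y l') (hl : l ≠ l') :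
    LatticeReach T occ x y := by
  have hp : ∀ j, z j - L ≤ Function.update x l' (y l') j ∧
      Function.update x l' (y l') j ≤ z j + L := by
    intro j
    rcases eq_or_ne j l' with rfl | hj
    · simpa using hy.1 j
    · simpa [hj] using hx.1 j
  have hE := LatticeReach.equivalence hT occ
  exact hE.trans (hx.reach_of_eq hT hp (by simp [hl]))
    (hE.symm (hy.reach_of_eq hT hp (by simp)))

/-- Parallel slabs need not meet, but a full slab in another direction crosses both. It exists
because the window has `2L + 1` heights and fewer than `K ≤ L` vacancies. -/
theorem OnFullSlab.reach [Nontrivial (Fin d)] (hT : IsStepSet T)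
    (hV : ∀ z, (vacantSites occ L z).card < K) (hKL : K ≤ L) {z x y : Fin d → ℤ} {l l' : Fin d}
    (hx : OnFullSlab occ L z x l) (hy : OnFullSlab occ L z y l') : LatticeReach T occ x y := by
  rcases eq_or_ne l l' with rfl | hl
  · obtain ⟨j, hj⟩ := exists_ne l
    obtain ⟨a, ha, ha'⟩ := exists_full_height (vacantSites occ L z)
      (Finset.Icc (z j - L) (z j + L)) j (by have := hV z; simp only [Int.card_Icc]; omega)
    have hp : OnFullSlab occ L z (Function.update x j a) j := by
      refine onFullSlab_of_forall_vacant (fun i => ?_) (by simpa using ha')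
      rcases eq_or_ne i j with rfl | hi
      · simpa using ha
      · simpa [hi] using hx.1 i
    exact (LatticeReach.equivalence hT occ).trans (hx.reach_of_ne hT hp hj.symm)
      (hp.reach_of_ne hT hy hj)
  · exact hx.reach_of_ne hT hy hl

/-- All full slabs of all windows lie in one component. -/
theorem OnFullSlab.reach_of_windows [Nontrivial (Fin d)] (hT : IsStepSet T)
    (hV : ∀ z, (vacantSites occ L z).card < K) (hKL : K ≤ L) {z z' x y : Fin d → ℤ}
    {l l' : Fin d} (hx : OnFullSlab occ L z x l) (hy : OnFullSlab occ L z' y l') :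
    LatticeReach T occ x y := by
  have hE := LatticeReach.equivalence hT occ
  -- Windows centred at neighbours `z` and `z + e_l` share all `2L + 1` heights in a direction `j ≠
  -- l`. Together they have fewer than `2K ≤ 2L` vacant sites, so one height is full in both.
  have common : ∀ (z : Fin d → ℤ) (l : Fin d), ∃ x j, OnFullSlab occ L z x j ∧
      OnFullSlab occ L (z + Pi.single l 1) x j := by
    intro z l
    obtain ⟨j, hj⟩ := exists_ne l
    have h1 := hV z
    have h2 := hV (z + Pi.single l 1)
    obtain ⟨a, ha, ha'⟩ := exists_full_height
      (vacantSites occ L z ∪ vacantSites occ L (z + Pi.single l 1))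
      (Finset.Icc (z j - L) (z j + L)) j (by
        have := Finset.card_union_le (vacantSites occ L z)
          (vacantSites occ L (z + Pi.single l 1))
        simp only [Int.card_Icc]; omega)
    refine ⟨Function.update z j a, j, onFullSlab_of_forall_vacant (fun i => ?_)
      (fun y hy => by simpa using ha' y (Finset.mem_union_left _ hy)),
      onFullSlab_of_forall_vacant (fun i => ?_)
      (fun y hy => by simpa using ha' y (Finset.mem_union_right _ hy))⟩
    · rcases eq_or_ne i j with rfl | hi
      · simpa using ha
      · simp [hi]
    · rcases eq_or_ne i j with rfl | hi
      · simpa [hj] using ha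
      · rcases eq_or_ne i l with rfl | hil
        · simp [hi]; omega
        · simp [hi, hil]
  refine lattice_rel_total (fun z z' => ∀ x y l l', OnFullSlab occ L z x l →
    OnFullSlab occ L z' y l' → LatticeReach T occ x y) ⟨?_, ?_, ?_⟩ ?_ z z' x y l l' hx hy
  · exact fun z x y l l' hx hy => hx.reach hT hV hKL hy
  · exact fun h x y l l' hx hy => hE.symm (h _ _ _ _ hy hx)
  -- Transitivity needs an actual full slab in the middle window, which `common` supplies.
  · intro z1 z2 z3 h h' x y l l' hx hy
    obtain ⟨p, j, hp, -⟩ := common z2 l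
    exact hE.trans (h _ _ _ _ hx hp) (h' _ _ _ _ hp hy)
  · intro z i x y l l' hx hy
    obtain ⟨p, j, hp, hp'⟩ := common z i
    exact hE.trans (hx.reach hT hV hKL hp) (hp'.reach hT hV hKL hy)

/-- Every occupied site is connected to a full slab. -/
theorem exists_onFullSlab_reach (hT : IsStepSet T) {M : ℕ}
    (hM : ∀ k ∈ T, ∀ l, |k l| ≤ M) (hV : ∀ z, (vacantSites occ L z).card < T.card - 1)
    (hL : T.card + M ≤ L) {x : Fin d → ℤ} (hx : x ∈ occ) :
    ∃ z y l, OnFullSlab occ L z y l ∧ LatticeReach T occ x y := by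
  classical
  by_contra! hno
  -- If the component of `x` meets no full slab, it will be confined between full heights `b l < x l
  -- < a l`. Each side offers `|T|` candidate heights against fewer than `|T| - 1` vacancies.
  have up : ∀ l, ∃ a : ℤ, (x l + 1 ≤ a ∧ a ≤ x l + T.card) ∧
      ∀ y ∈ vacantSites occ L x, y l ≠ a := fun l => by
    obtain ⟨a, ha, ha'⟩ := exists_full_height (vacantSites occ L x)
      (Finset.Icc (x l + 1) (x l + T.card)) l (by
        have := hV x; simp only [Int.card_Icc]; omega)
    exact ⟨a, Finset.mem_Icc.1 ha, ha'⟩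
  have dn : ∀ l, ∃ a : ℤ, (x l - T.card ≤ a ∧ a ≤ x l - 1) ∧
      ∀ y ∈ vacantSites occ L x, y l ≠ a := fun l => by
    obtain ⟨a, ha, ha'⟩ := exists_full_height (vacantSites occ L x)
      (Finset.Icc (x l - T.card) (x l - 1)) l (by
        have := hV x; simp only [Int.card_Icc]; omega)
    exact ⟨a, Finset.mem_Icc.1 ha, ha'⟩
  choose a ha ha' using up
  choose b hb hb' using dn
  have hconf : ∀ y, LatticeReach T occ x y → y ∈ occ ∧ ∀ l, b l < y l ∧ y l < a l := by
    intro y hy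
    induction hy with
    | refl => exact ⟨hx, fun l => by have := ha l; have := hb l; omega⟩
    | @tail y y' hy hst ih =>
      refine ⟨hst.2.1, fun l => ?_⟩
      have hwin : ∀ e, b l ≤ e → e ≤ a l → ∀ j, x j - L ≤ Function.update y l e j ∧
          Function.update y l e j ≤ x j + L := by
        intro e he he' j
        rcases eq_or_ne j l with rfl | hj
        · have := ha j; have := hb j; simp only [Function.update_self]; omega
        · have := ha j; have := hb j; have := ih.2 j; simp only [Function.update_of_ne hj]; omega
      -- A step reaching or jumping over a full height `e` can be shortened, by `single_mem`, to an
      -- axis step that lands on it. The landing site is occupied, so a full slab would be reached.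
      have hcross : ∀ e, b l ≤ e → e ≤ a l → (∀ y ∈ vacantSites occ L x, y l ≠ e) →
          |e - y l| ≤ |(y' - y) l| → False := by
        intro e he he' hfull hle
        have hs : OnFullSlab occ L x (Function.update y l e) l :=
          onFullSlab_of_forall_vacant (hwin e he he') (by simpa using hfull)
        refine hno _ _ _ hs (Relation.ReflTransGen.tail hy ⟨ih.1, hs.2 _ hs.1 rfl, ?_⟩)
        have : Function.update y l e - y = Pi.single l (e - y l) := by
          ext j
          rcases eq_or_ne j l with rfl | hj
          · simp
          · simp [hj]
        rw [this]
        exact hT.single_mem _ hst.2.2 _ _ hle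
      have h1 := ih.2 l
      have h2 := ha l
      have h3 := hb l
      constructor
      · by_contra! h
        refine hcross (b l) le_rfl (by omega) (hb' l) ?_
        rw [Pi.sub_apply, abs_of_nonpos (by omega), abs_of_nonpos (by omega)]
        omega
      · by_contra! h
        refine hcross (a l) (by omega) le_rfl (ha' l) ?_
        rw [Pi.sub_apply, abs_of_nonneg (by omega), abs_of_nonneg (by omega)]
        omega
  have hfin : {y | LatticeReach T occ x y}.Finite :=
    (Set.finite_Icc b a).subset fun y hy =>
      ⟨fun l => ((hconf y hy).2 l).1.le, fun l => ((hconf y hy).2 l).2.le⟩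
  set C := hfin.toFinset with hC
  have hxC : x ∈ C := by
    simpa [hC] using (LatticeReach.equivalence hT occ).refl x
  -- Any occupied site of `C + T` already belongs to the component. The margin `M` in `hL` keeps `C
  -- + T` inside the window.
  have hsub : (C + T) \ C ⊆ vacantSites occ L x := by
    intro y hy
    obtain ⟨hy1, hy2⟩ := Finset.mem_sdiff.1 hy
    obtain ⟨c, hc, k, hk, rfl⟩ := Finset.mem_add.1 hy1
    have hc' : LatticeReach T occ x c := by simpa [hC] using hc
    refine mem_vacantSites.2 ⟨fun j => ?_, fun ho => hy2 ?_⟩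
    · have h1 := (hconf c hc').2 j
      have h2 := abs_le.1 (hM k hk j)
      have h3 := ha j
      have h4 := hb j
      simp only [Pi.add_apply]
      omega
    · rw [hC, hfin.mem_toFinset]
      exact Relation.ReflTransGen.tail hc' ⟨(hconf c hc').1, ho, by simpa⟩
  have h1 := Finset.card_le_card hsub
  have h2 := Finset.le_card_sdiff C (C + T)
  -- Cauchy–Davenport produces at least `|T| - 1` sites in `(C + T) \ C`, contradicting the bound on
  -- vacancies.
  have h3 := cauchy_davenport_of_isAddTorsionFree (s := C) (t := T) ⟨x, hxC⟩ ⟨0, hT.zero_mem⟩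
  have h4 := hV x
  omega

/-- If every window has fewer than `|T| - 1` vacant sites, then the occupied sites are connected by
steps in `T`. -/
theorem latticeReach_of_few_vacant [Nontrivial (Fin d)] (hT : IsStepSet T) {M : ℕ}
    (hM : ∀ k ∈ T, ∀ l, |k l| ≤ M) (hV : ∀ z, (vacantSites occ L z).card < T.card - 1)
    (hL : T.card + M ≤ L) :
    occ.Nonempty ∧ ∀ x ∈ occ, ∀ y ∈ occ, LatticeReach T occ x y := by
  constructor
  · by_contra h
    rw [Set.not_nonempty_iff_eq_empty] at h
    obtain ⟨l, -⟩ := exists_ne (⟨0, by have := Fin.nontrivial_iff_two_le.1 ‹_›; omega⟩ : Fin d)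
    obtain ⟨a, ha, ha'⟩ := exists_full_height (vacantSites occ L 0) (Finset.Icc (-(L : ℤ)) L) l
      (by have := hV 0; simp only [Int.card_Icc]; omega)
    refine ha' (Pi.single l a) (mem_vacantSites.2 ⟨fun j => ?_, by simp [h]⟩) (by simp)
    rcases eq_or_ne j l with rfl | hj
    · simpa using ha
    · simp [hj]
  · intro x hx y hy
    have hE := LatticeReach.equivalence hT occ
    obtain ⟨z, p, l, hp, hxp⟩ := exists_onFullSlab_reach hT hM hV hL hx
    obtain ⟨z', p', l', hp', hyp⟩ := exists_onFullSlab_reach hT hM hV hL hy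
    exact hE.trans hxp (hE.trans (hp.reach_of_windows hT hV (by omega) hp') (hE.symm hyp))

end

/-! ## Mutually visible blocks -/

open Classical in
/-- The steps between blocks of side at most `c` times the visibility radius that guarantee mutual
visibility. -/
noncomputable def visibleSteps (d : ℕ) (c : ℝ) : Finset (Fin d → ℤ) :=
  (Fintype.piFinset fun _ => Finset.Icc (-⌈1 / c⌉) ⌈1 / c⌉).filter
    (fun k => c ^ 2 * ∑ l, (|(k l : ℝ)| + 1) ^ 2 ≤ 1)

/-- The cube in the definition only secures finiteness: the quadratic condition already forces `c
(|k l| + 1) ≤ 1` for each `l`. -/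
theorem mem_visibleSteps {d : ℕ} {c : ℝ} (hc : 0 < c) {k : Fin d → ℤ} :
    k ∈ visibleSteps d c ↔ c ^ 2 * ∑ l, (|(k l : ℝ)| + 1) ^ 2 ≤ 1 := by
  simp only [visibleSteps, Finset.mem_filter, Fintype.mem_piFinset, Finset.mem_Icc,
    and_iff_right_iff_imp]
  intro h l
  have h1 : (|(k l : ℝ)| + 1) ^ 2 ≤ ∑ l, (|(k l : ℝ)| + 1) ^ 2 :=
    Finset.single_le_sum (f := fun l => (|(k l : ℝ)| + 1) ^ 2) (fun _ _ => sq_nonneg _)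
      (Finset.mem_univ l)
  have h2 : (c * (|(k l : ℝ)| + 1)) ^ 2 ≤ 1 ^ 2 := by
    rw [mul_pow, one_pow]
    exact (mul_le_mul_of_nonneg_left h1 (sq_nonneg c)).trans h
  have h3 := abs_le_of_sq_le_sq h2 zero_le_one
  have h4 : |(k l : ℝ)| ≤ 1 / c := by
    rw [le_div_iff₀ hc]
    rw [abs_of_nonneg (by positivity)] at h3
    nlinarith
  have h5 : ((|k l| : ℤ) : ℝ) ≤ (⌈1 / c⌉ : ℤ) := by
    push_cast
    exact h4.trans (Int.le_ceil _)
  exact abs_le.1 (by exact_mod_cast h5)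

/-- The binding case is a unit step, for which the sum of squares is `4 + (d - 1) = d + 3`. -/
theorem isStepSet_visibleSteps {d : ℕ} {c : ℝ} (hc : 0 < c) (hcd : c ^ 2 * (d + 3) ≤ 1) :
    IsStepSet (visibleSteps d c) where
  zero_mem := by
    rw [mem_visibleSteps hc]
    simp
    nlinarith [sq_nonneg c]
  neg_mem k hk := by
    rw [mem_visibleSteps hc] at hk ⊢
    simpa using hk
  unit_mem l := by
    rw [mem_visibleSteps hc]
    refine le_trans (mul_le_mul_of_nonneg_left (le_of_eq ?_) (sq_nonneg c)) hcd
    have : ∀ j, (|((Pi.single l 1 : Fin d → ℤ) j : ℝ)| + 1) ^ 2 =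
        1 + if j = l then (3 : ℝ) else 0 := by
      intro j
      rcases eq_or_ne j l with rfl | hj
      · simp; norm_num
      · simp [hj]
    simp [this, Finset.sum_add_distrib]
  single_mem k hk l a ha := by
    rw [mem_visibleSteps hc] at hk ⊢
    refine le_trans (mul_le_mul_of_nonneg_left (Finset.sum_le_sum fun j _ => ?_)
      (sq_nonneg c)) hk
    have : |((Pi.single l a : Fin d → ℤ) j : ℝ)| ≤ |(k j : ℝ)| := by
      rcases eq_or_ne j l with rfl | hj
      · simp only [Pi.single_eq_same]
        exact_mod_cast ha
      · simp [hj]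
    gcongr

/-- A ball is covered by the unit cubes around the visible steps. -/
theorem unitBallVolume_mul_le {d : ℕ} {c : ℝ} (hc : 0 < c)
    (hρ : 0 < 1 - 3 * Real.sqrt d * c / 2) :
    unitBallVolume d * (1 - 3 * Real.sqrt d * c / 2) ^ d ≤ c ^ d * (visibleSteps d c).card := by
  set ρ := 1 - 3 * Real.sqrt d * c / 2 with hρdef
  let cube : (Fin d → ℤ) → Set (EuclideanSpace ℝ (Fin d)) := fun k =>
    (WithLp.ofLp) ⁻¹' (Set.Icc (fun l => (k l : ℝ) - 1 / 2) (fun l => (k l : ℝ) + 1 / 2))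
  have hcube : ∀ k, volume (cube k) = 1 := by
    intro k
    rw [(PiLp.volume_preserving_ofLp (Fin d)).measure_preimage
      measurableSet_Icc.nullMeasurableSet, Real.volume_Icc_pi]
    refine Finset.prod_eq_one fun l _ => ?_
    rw [← ENNReal.ofReal_one]
    congr 1
    ring
  -- Round each coordinate. Rounding costs `1/2` and the step condition adds `1`, so every
  -- coordinate grows by at most `3/2`. By Cauchy–Schwarz the norm grows by at most `3√d/2`, whence
  -- the radius `ρ / c`.
  have hsub : Metric.ball (0 : EuclideanSpace ℝ (Fin d)) (ρ / c) ⊆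
      ⋃ k ∈ visibleSteps d c, cube k := by
    intro x hx
    rw [mem_ball_zero_iff] at hx
    have hr : ∀ l, |x l - round (x l)| ≤ 1 / 2 := fun l => abs_sub_round _
    refine Set.mem_iUnion₂.2 ⟨fun l => round (x l), ?_, ?_⟩
    · rw [mem_visibleSteps hc]
      have hX : ∑ l, |x l| ^ 2 = ‖x‖ ^ 2 := by
        rw [EuclideanSpace.norm_sq_eq]; simp
      have hS : ∑ l, |x l| ≤ Real.sqrt d * ‖x‖ := by
        refine abs_le_of_sq_le_sq' ?_ (by positivity) |>.2
        rw [mul_pow, Real.sq_sqrt (Nat.cast_nonneg d), ← hX]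
        simpa using sq_sum_le_card_mul_sum_sq (s := Finset.univ) (f := fun l => |x l|)
      have h1 : ∑ l, (|((round (x l) : ℤ) : ℝ)| + 1) ^ 2 ≤ (‖x‖ + 3 / 2 * Real.sqrt d) ^ 2 := by
        calc ∑ l, (|((round (x l) : ℤ) : ℝ)| + 1) ^ 2 ≤ ∑ l, (|x l| + 3 / 2) ^ 2 := by
              refine Finset.sum_le_sum fun l _ => ?_
              have h1 : |((round (x l) : ℤ) : ℝ)| ≤ |x l| + 1 / 2 := by
                have := abs_sub_abs_le_abs_sub ((round (x l) : ℤ) : ℝ) (x l)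
                rw [abs_sub_comm] at this
                linarith [hr l]
              refine pow_le_pow_left₀ (by positivity) (by linarith) 2
          _ = ‖x‖ ^ 2 + 3 * ∑ l, |x l| + 9 / 4 * d := by
              rw [← hX, Finset.mul_sum]
              simp only [add_sq, Finset.sum_add_distrib]
              simp
              congr 1
              · congr 1
                refine Finset.sum_congr rfl fun l _ => by ring
              · ring
          _ ≤ ‖x‖ ^ 2 + 3 * (Real.sqrt d * ‖x‖) + 9 / 4 * (Real.sqrt d) ^ 2 := by
              rw [Real.sq_sqrt (Nat.cast_nonneg d)]
              gcongr
          _ = _ := by ring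
      have h2 : ‖x‖ * c < ρ := by rwa [lt_div_iff₀ hc] at hx
      calc c ^ 2 * ∑ l, (|((round (x l) : ℤ) : ℝ)| + 1) ^ 2
          ≤ c ^ 2 * (‖x‖ + 3 / 2 * Real.sqrt d) ^ 2 := by gcongr
        _ = (‖x‖ * c + 3 * Real.sqrt d * c / 2) ^ 2 := by ring
        _ ≤ 1 ^ 2 := by
            refine pow_le_pow_left₀ (by positivity) ?_ 2
            linarith
        _ = 1 := one_pow 2
    · constructor <;> intro l <;> have := abs_le.1 (hr l) <;> simp only <;> linarith
  have h1 : volume (Metric.ball (0 : EuclideanSpace ℝ (Fin d)) (ρ / c)) ≤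
      ((visibleSteps d c).card : ℝ≥0∞) := by
    refine (measure_mono hsub).trans ((measure_biUnion_finset_le _ _).trans ?_)
    simp [hcube]
  have hpos : 0 < ρ / c := div_pos hρ hc
  rw [Measure.addHaar_ball_of_pos _ _ hpos, finrank_euclideanSpace, Fintype.card_fin] at h1
  have h2 := ENNReal.toReal_mono (ENNReal.natCast_ne_top _) h1
  rw [ENNReal.toReal_mul, ENNReal.toReal_ofReal (by positivity), ENNReal.toReal_natCast, div_pow,
    div_mul_eq_mul_div, div_le_iff₀ (by positivity)] at h2
  unfold unitBallVolume
  linarith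

/-- Blocks whose indices differ, modulo the number of blocks per side, by a visible step are
mutually visible. -/
theorem mutuallyVisible_block {d n : ℕ} {χ c : ℝ} (hc : 0 < c)
    (hs : sideLength d n / blocksPerSide d n χ ≤ c * visRadius d n)
    (hR : 0 ≤ visRadius d n) {i j : Fin d → Fin (blocksPerSide d n χ)} {k : Fin d → ℤ}
    (hk : k ∈ visibleSteps d c)
    (hij : ∀ l, ∃ q : ℤ, ((j l : ℕ) : ℤ) = (i l : ℕ) + k l + blocksPerSide d n χ * q) :
    MutuallyVisible d n (block d n χ i) (block d n χ j) := by
  intro x hx y hy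
  set m : ℝ := ((blocksPerSide d n χ : ℕ) : ℝ) with hm
  set s := sideLength d n / m with hsdef
  have hside : 0 ≤ sideLength d n := Real.rpow_nonneg (Nat.cast_nonneg _) _
  have hs0 : 0 ≤ s := div_nonneg hside (Nat.cast_nonneg _)
  have hcoord : ∀ l, min |x l - y l| (sideLength d n - |x l - y l|) ^ 2 ≤
      (s * (|(k l : ℝ)| + 1)) ^ 2 := by
    intro l
    obtain ⟨q, hq⟩ := hij l
    have hmpos : 0 < m := by
      rw [hm]
      exact_mod_cast (i l).pos
    have hms : sideLength d n = m * s := by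
      rw [hsdef]; field_simp
    have hq' : ((j l : ℕ) : ℝ) = (i l : ℕ) + k l + m * q := by
      rw [hm]
      exact_mod_cast hq
    obtain ⟨hx1, hx2⟩ := hx l
    obtain ⟨hy1, hy2⟩ := hy l
    rw [← hm, ← hsdef] at hx1 hx2 hy1 hy2
    have hi : ((i l : ℕ) : ℝ) + 1 ≤ m := by
      rw [hm]
      exact_mod_cast (i l).isLt
    have hj : ((j l : ℕ) : ℝ) + 1 ≤ m := by
      rw [hm]
      exact_mod_cast (j l).isLt
    have hi0 : 0 ≤ ((i l : ℕ) : ℝ) * s := by positivity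
    have hj0 : 0 ≤ ((j l : ℕ) : ℝ) * s := by positivity
    have hi1 : (((i l : ℕ) : ℝ) + 1) * s ≤ m * s := by gcongr
    have hj1 : (((j l : ℕ) : ℝ) + 1) * s ≤ m * s := by gcongr
    have hD : |x l - y l| ≤ sideLength d n := abs_le.2 ⟨by linarith, by linarith⟩
    have hmin : 0 ≤ min |x l - y l| (sideLength d n - |x l - y l|) :=
      le_min (abs_nonneg _) (by linarith)
    refine pow_le_pow_left₀ hmin ?_ 2
    -- The integer `q` counts turns around the torus. After removing them, `y l - x l` differs from
    -- `k l * s` by at most one block side.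
    have hw : |y l - x l - q * sideLength d n| ≤ s * (|(k l : ℝ)| + 1) := by
      have e1 : ((j l : ℕ) : ℝ) * s = (i l : ℕ) * s + k l * s + q * sideLength d n := by
        rw [hq', hms]; ring
      have e2 : |y l - x l - q * sideLength d n - k l * s| ≤ s :=
        abs_le.2 ⟨by linarith, by linarith⟩
      have e3 := abs_sub_abs_le_abs_sub (y l - x l - q * sideLength d n) (k l * s)
      rw [abs_mul, abs_of_nonneg hs0] at e3
      linarith
    rw [abs_sub_comm (x l)]
    rcases eq_or_ne q 0 with rfl | hq0
    · exact (min_le_left _ _).trans (by simpa using hw)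
    -- For `q ≠ 0` the other branch of the toroidal distance is used: one side length is at most
    -- `|q|` side lengths.
    · refine (min_le_right _ _).trans ?_
      have hq1 : (1 : ℝ) ≤ |(q : ℝ)| := by exact_mod_cast Int.one_le_abs hq0
      have e4 := abs_sub_abs_le_abs_sub (q * sideLength d n) (y l - x l)
      rw [abs_mul, abs_of_nonneg hside, abs_sub_comm (_ * _)] at e4
      have e5 := le_mul_of_one_le_left hside hq1
      linarith
  have hk' := (mem_visibleSteps hc).1 hk
  refine Real.sqrt_le_iff.2 ⟨hR, ?_⟩
  calc _ ≤ ∑ l, (s * (|(k l : ℝ)| + 1)) ^ 2 := Finset.sum_le_sum fun l _ => hcoord l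
    _ = s ^ 2 * ∑ l, (|(k l : ℝ)| + 1) ^ 2 := by simp only [mul_pow, Finset.mul_sum]
    _ ≤ (c * visRadius d n) ^ 2 * ∑ l, (|(k l : ℝ)| + 1) ^ 2 := by gcongr
    _ = visRadius d n ^ 2 * (c ^ 2 * ∑ l, (|(k l : ℝ)| + 1) ^ 2) := by ring
    _ ≤ visRadius d n ^ 2 * 1 := by gcongr
    _ = _ := mul_one _

-- Measure and disjointness of the blocks

theorem block_eq_pi (d n : ℕ) (χ : ℝ) (i : Fin d → Fin (blocksPerSide d n χ)) :
    block d n χ i = Set.pi Set.univ fun l => Set.Ico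
      (-(sideLength d n) / 2 + (i l : ℝ) * (sideLength d n / blocksPerSide d n χ))
      (-(sideLength d n) / 2 + ((i l : ℝ) + 1) * (sideLength d n / blocksPerSide d n χ)) := by
  ext x
  simp [block]

theorem measurableSet_block (d n : ℕ) (χ : ℝ) (i : Fin d → Fin (blocksPerSide d n χ)) :
    MeasurableSet (block d n χ i) := by
  rw [block_eq_pi]
  exact MeasurableSet.univ_pi fun _ => measurableSet_Ico

theorem volume_block (d n : ℕ) (χ : ℝ) (i : Fin d → Fin (blocksPerSide d n χ)) :
    volume (block d n χ i) =
      ENNReal.ofReal ((sideLength d n / blocksPerSide d n χ) ^ d) := by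
  have hside : 0 ≤ sideLength d n := Real.rpow_nonneg (Nat.cast_nonneg _) _
  rw [block_eq_pi, Real.volume_pi_Ico, ENNReal.ofReal_pow (by positivity)]
  rw [Finset.prod_congr rfl (g := fun _ =>
    ENNReal.ofReal (sideLength d n / blocksPerSide d n χ))]
  · simp
  · intro l _
    congr 1
    ring

theorem block_subset_region (d n : ℕ) (χ : ℝ) (i : Fin d → Fin (blocksPerSide d n χ)) :
    block d n χ i ⊆ region d n := by
  intro x hx
  have hside : 0 ≤ sideLength d n := Real.rpow_nonneg (Nat.cast_nonneg _) _
  have key : ∀ l, -(sideLength d n) / 2 ≤ x l ∧ x l ≤ sideLength d n / 2 := by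
    intro l
    obtain ⟨h1, h2⟩ := hx l
    have hm : (0 : ℝ) < blocksPerSide d n χ := by exact_mod_cast (i l).pos
    have hs : 0 ≤ sideLength d n / blocksPerSide d n χ := by positivity
    have hi : ((i l : ℕ) : ℝ) + 1 ≤ blocksPerSide d n χ := by exact_mod_cast (i l).isLt
    have e : (blocksPerSide d n χ : ℝ) * (sideLength d n / blocksPerSide d n χ) =
        sideLength d n := by field_simp
    have e1 := mul_le_mul_of_nonneg_right hi hs
    have e2 : 0 ≤ ((i l : ℕ) : ℝ) * (sideLength d n / blocksPerSide d n χ) := by positivity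
    constructor <;> linarith
  exact ⟨fun l => (key l).1, fun l => (key l).2⟩

theorem disjoint_block {d n : ℕ} {χ : ℝ} {i j : Fin d → Fin (blocksPerSide d n χ)}
    (hij : i ≠ j) : Disjoint (block d n χ i) (block d n χ j) := by
  rw [Set.disjoint_left]
  intro x hx hy
  refine hij (funext fun l => ?_)
  have hside : 0 ≤ sideLength d n := Real.rpow_nonneg (Nat.cast_nonneg _) _
  have hm : (0 : ℝ) < blocksPerSide d n χ := by exact_mod_cast (i l).pos
  have hs : 0 ≤ sideLength d n / blocksPerSide d n χ := by positivity
  obtain ⟨hx1, hx2⟩ := hx l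
  obtain ⟨hy1, hy2⟩ := hy l
  have h1 : ((i l : ℕ) : ℝ) < (j l : ℕ) + 1 := lt_of_mul_lt_mul_right (by linarith) hs
  have h2 : ((j l : ℕ) : ℝ) < (i l : ℕ) + 1 := lt_of_mul_lt_mul_right (by linarith) hs
  have h1' : (i l : ℕ) < (j l : ℕ) + 1 := by exact_mod_cast h1
  have h2' : (j l : ℕ) < (i l : ℕ) + 1 := by exact_mod_cast h2
  exact Fin.ext (by omega)

/-! ## Lower tails of community counts -/

/-- The probability generating function of the Poisson law. -/
theorem lintegral_pow_poissonMeasure (a : ℝ≥0) {q : ℝ} (hq : 0 ≤ q) :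
    ∫⁻ k, ENNReal.ofReal q ^ k ∂(poissonMeasure a) =
      ENNReal.ofReal (Real.exp (-(a * (1 - q)))) := by
  lift q to ℝ≥0 using hq
  rw [lintegral_countable']
  -- The series is `exp (-(a (1 - q)))` times the total mass of the Poisson law of mean `a q`.
  have h := (hasSum_one_poissonMeasure (a * q)).mul_left (Real.exp (-(a * (1 - q))))
  rw [mul_one] at h
  rw [← h.tsum_eq, ENNReal.ofReal_tsum_of_nonneg (fun k => by positivity) h.summable]
  refine tsum_congr fun k => ?_
  rw [poissonMeasure_singleton, ← ENNReal.ofReal_pow q.coe_nonneg, ← ENNReal.ofReal_mul (by positivity)]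
  congr 1
  have : Real.exp (-(a : ℝ)) = Real.exp (-(a * (1 - q))) * Real.exp (-(a * q)) := by
    rw [← Real.exp_add]; congr 1; ring
  rw [this]
  push_cast
  ring

section

variable {Ω : Type*} [MeasurableSpace Ω] {d k n : ℕ} {μ : Measure Ω} {θ : GHCMParams k}
  {G : GraphSample Ω d k}

theorem IsGHCM.measurable_communityCount (hG : IsGHCM μ θ d n G) (i : Fin k)
    {A : Set (Fin d → ℝ)} (hA : MeasurableSet A) :
    Measurable fun ω => G.communityCount i ω A := by
  classical
  have h : Measurable fun p : ℕ × Ω =>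
      ((Finset.range p.1).filter (fun u => G.label u p.2 = i ∧ G.loc u p.2 ∈ A)).card := by
    refine measurable_from_prod_countable_right fun N => ?_
    simp only [Finset.card_filter]
    refine Finset.measurable_sum _ fun u _ => Measurable.ite ?_ measurable_const measurable_const
    exact (hG.label_measurable u (measurableSet_singleton i)).inter
      (hG.loc_poisson.measurable_point u hA)
  have h' := h.comp (hG.loc_poisson.measurable_number.prodMk measurable_id)
  convert h' using 2
  simp only [GraphSample.communityCount, Function.comp, id]

theorem IsGHCM.lintegral_label [IsProbabilityMeasure μ] (hG : IsGHCM μ θ d n G) (i : Fin k)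
    (u : ℕ) {q : ℝ} (hq : 0 ≤ q) :
    ∫⁻ ω, (if G.label u ω = i then ENNReal.ofReal q else 1) ∂μ =
      ENNReal.ofReal (1 - θ.prior i * (1 - q)) := by
  have hm : MeasurableSet {ω | G.label u ω = i} :=
    hG.label_measurable u (measurableSet_singleton i)
  have hp1 : θ.prior i ≤ 1 := by
    rw [← θ.prior_sum]
    exact Finset.single_le_sum (fun j _ => θ.prior_nonneg j) (Finset.mem_univ i)
  have hc : μ {ω | G.label u ω = i}ᶜ = ENNReal.ofReal (1 - θ.prior i) := by
    rw [prob_compl_eq_one_sub hm, hG.label_law, ENNReal.ofReal_sub _ (θ.prior_nonneg i),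
      ENNReal.ofReal_one]
  have h1 : ∫⁻ ω in {ω | G.label u ω = i}, (if G.label u ω = i then ENNReal.ofReal q else 1) ∂μ =
      ∫⁻ _ in {ω | G.label u ω = i}, ENNReal.ofReal q ∂μ :=
    setLIntegral_congr_fun hm fun ω hω => if_pos hω
  have h2 : ∫⁻ ω in {ω | G.label u ω = i}ᶜ, (if G.label u ω = i then ENNReal.ofReal q else 1) ∂μ =
      ∫⁻ _ in {ω | G.label u ω = i}ᶜ, 1 ∂μ :=
    setLIntegral_congr_fun hm.compl fun ω hω => if_neg hω
  rw [← lintegral_add_compl _ hm, h1, h2, setLIntegral_const, setLIntegral_const, hc, hG.label_law, one_mul,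
    ← ENNReal.ofReal_mul hq, ← ENNReal.ofReal_add (mul_nonneg hq (θ.prior_nonneg i)) (by linarith)]
  congr 1
  ring

/-- Independent thinning by the labels, at the level of generating functions. -/
theorem IsGHCM.lintegral_pow_communityCount_eq [IsProbabilityMeasure μ]
    (hG : IsGHCM μ θ d n G) (i : Fin k) {A : Set (Fin d → ℝ)} (hA : MeasurableSet A) {q : ℝ}
    (hq : 0 ≤ q) :
    ∫⁻ ω, ENNReal.ofReal q ^ G.communityCount i ω A ∂μ =
      ∫⁻ ω, ENNReal.ofReal (1 - θ.prior i * (1 - q)) ^ pointCount G.number G.loc A ω ∂μ := by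
  classical
  -- `J` is the random set of indices of points in `A`, and `S F` is the event `J = F`. It depends
  -- on the locations only, so given `J = F` the labels in `F` are still independent with law
  -- `prior`. Summing over the countably many `F` gives the identity.
  let J : Ω → Finset ℕ := fun ω => (Finset.range (G.number ω)).filter fun u => G.loc u ω ∈ A
  let S : Finset ℕ → Set (ℕ × (ℕ → (Fin d → ℝ))) := fun F =>
    {c | ∀ u, (u < c.1 ∧ c.2 u ∈ A) ↔ u ∈ F}
  have hS : ∀ F, MeasurableSet (S F) := by
    intro F
    simp only [S, Set.ofPred_forall]
    refine MeasurableSet.iInter fun u => ?_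
    have h1 : MeasurableSet {c : ℕ × (ℕ → (Fin d → ℝ)) | u < c.1 ∧ c.2 u ∈ A} :=
      (measurable_fst (measurableSet_Ioi (a := u))).inter
        (((measurable_pi_apply u).comp measurable_snd) hA)
    by_cases hu : u ∈ F
    · simpa [hu] using h1
    · simp only [hu, iff_false]
      exact h1.compl
  have hJS : ∀ F ω, J ω = F ↔ (G.number ω, fun u => G.loc u ω) ∈ S F := by
    intro F ω
    simp [J, S, Finset.ext_iff]
  have expand : ∀ (f : Finset ℕ → Ω → ℝ≥0∞), (∀ F, Measurable (f F)) →
      ∫⁻ ω, f (J ω) ω ∂μ =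
        ∑' F, ∫⁻ ω, (S F).indicator 1 (G.number ω, fun u => G.loc u ω) * f F ω ∂μ := by
    intro f hf
    have hXm : Measurable fun ω => (G.number ω, fun u => G.loc u ω) :=
      hG.loc_poisson.measurable_number.prodMk
        (measurable_pi_lambda _ hG.loc_poisson.measurable_point)
    rw [← lintegral_tsum]
    · refine lintegral_congr fun ω => ?_
      rw [tsum_eq_single (J ω)]
      · rw [Set.indicator_of_mem ((hJS _ _).1 rfl)]; simp
      · intro F hF
        rw [Set.indicator_of_notMem fun h => hF ((hJS _ _).2 h).symm, zero_mul]
    · intro F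
      exact (((measurable_one.indicator (hS F)).comp hXm).mul (hf F)).aemeasurable
  have hlab : ∀ (u : ℕ), Measurable fun x : Fin k => if x = i then ENNReal.ofReal q else 1 :=
    fun u => measurable_of_finite _
  have hL : ∀ ω, ENNReal.ofReal q ^ G.communityCount i ω A =
      ∏ u ∈ J ω, if G.label u ω = i then ENNReal.ofReal q else 1 := by
    intro ω
    rw [Finset.prod_ite, Finset.prod_const, Finset.prod_const_one, mul_one, Finset.filter_filter]
    unfold GraphSample.communityCount
    congr 2
    ext u
    simp [and_comm]
  have hR : ∀ ω, pointCount G.number G.loc A ω = (J ω).card := by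
    intro ω
    unfold pointCount
    congr 2
  simp only [hL, hR]
  rw [expand (fun F ω => ∏ u ∈ F, if G.label u ω = i then ENNReal.ofReal q else 1)
      (fun F => Finset.measurable_prod _ fun u _ => (hlab u).comp (hG.label_measurable u)),
    expand (fun F _ => ENNReal.ofReal (1 - θ.prior i * (1 - q)) ^ F.card)
      (fun F => measurable_const)]
  refine tsum_congr fun F => ?_
  have hind := hG.label_indep_loc.symm.comp (φ := (S F).indicator (1 : ℕ × (ℕ → (Fin d → ℝ)) → ℝ≥0∞))
    (ψ := fun x : ℕ → Fin k => ∏ u ∈ F, if x u = i then ENNReal.ofReal q else 1)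
    (measurable_one.indicator (hS F))
    (Finset.measurable_prod _ fun u _ => (hlab u).comp (measurable_pi_apply u))
  have hXm : Measurable fun ω => (G.number ω, fun u => G.loc u ω) :=
    hG.loc_poisson.measurable_number.prodMk
      (measurable_pi_lambda _ hG.loc_poisson.measurable_point)
  have h1 := lintegral_mul_eq_lintegral_mul_lintegral_of_indepFun''
    ((measurable_one.indicator (hS F)).comp hXm).aemeasurable
    (Finset.measurable_prod F fun u _ =>
      (hlab u).comp (hG.label_measurable u)).aemeasurable hind
  have h2 := lintegral_prod_eq_prod_lintegral_of_indepFun (μ := μ) F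
    (fun u ω => if G.label u ω = i then ENNReal.ofReal q else 1)
    (hG.label_iIndep.comp (fun _ x => if x = i then ENNReal.ofReal q else 1) hlab)
    (fun u => (hlab u).comp (hG.label_measurable u))
  simp only [hG.lintegral_label i _ hq, Finset.prod_const] at h2
  exact (h1.trans (congrArg _ h2)).trans
    (lintegral_mul_const _ ((measurable_one.indicator (hS F)).comp hXm)).symm

theorem IsGHCM.lintegral_pow_communityCount [IsProbabilityMeasure μ]
    (hG : IsGHCM μ θ d n G) (i : Fin k) {A : Set (Fin d → ℝ)} (hA : MeasurableSet A)
    (hAr : A ⊆ region d n) {q : ℝ} (hq : 0 ≤ q) :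
    ∫⁻ ω, ENNReal.ofReal q ^ G.communityCount i ω A ∂μ =
      ENNReal.ofReal (Real.exp (-(θ.prior i * θ.lam * (volume A).toReal * (1 - q)))) := by
  have hp1 : θ.prior i ≤ 1 := by
    rw [← θ.prior_sum]
    exact Finset.single_le_sum (fun j _ => θ.prior_nonneg j) (Finset.mem_univ i)
  have hp0 := θ.prior_nonneg i
  have hlaw := hG.loc_poisson.count_law A hA
  -- A push-forward along a map that is not a.e. measurable is zero by convention, so a nonzero law
  -- yields measurability.
  have hae : AEMeasurable (pointCount G.number G.loc A) μ :=
    aemeasurable_of_map_neZero (by rw [hlaw]; infer_instance)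
  rw [hG.lintegral_pow_communityCount_eq i hA hq,
    ← lintegral_map' (f := fun k => ENNReal.ofReal (1 - θ.prior i * (1 - q)) ^ k)
      (Measurable.of_discrete).aemeasurable hae, hlaw,
    lintegral_pow_poissonMeasure _ (by nlinarith)]
  congr 2
  rw [Measure.smul_apply, Measure.restrict_apply hA, Set.inter_eq_left.2 hAr, smul_eq_mul,
    ENNReal.coe_toNNReal_eq_toReal, ENNReal.toReal_mul, ENNReal.toReal_ofReal θ.lam_pos.le]
  ring

/-- The Chernoff bound for the lower tail of a community count. -/
theorem IsGHCM.communityCount_lt_le [IsProbabilityMeasure μ]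
    (hG : IsGHCM μ θ d n G) (i : Fin k) {A : Set (Fin d → ℝ)} (hA : MeasurableSet A)
    (hAr : A ⊆ region d n) {t : ℝ} (ht : 0 ≤ t) (x : ℝ) :
    μ {ω | (G.communityCount i ω A : ℝ) < x} ≤
      ENNReal.ofReal (Real.exp
        (t * x - θ.prior i * θ.lam * (volume A).toReal * (1 - Real.exp (-t)))) := by
  have hf : Measurable fun ω => ENNReal.ofReal (Real.exp (t * x)) *
      ENNReal.ofReal (Real.exp (-t)) ^ G.communityCount i ω A :=
    ((Measurable.of_discrete (f := fun j : ℕ => ENNReal.ofReal (Real.exp (-t)) ^ j)).comp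
      (hG.measurable_communityCount i hA)).const_mul _
  -- Markov's inequality for `exp (t (x - count))`, which is at least `1` when the count is below
  -- `x`.
  have h1 := mul_meas_ge_le_lintegral hf (μ := μ) 1
  rw [one_mul, lintegral_const_mul' _ _ ENNReal.ofReal_ne_top,
    hG.lintegral_pow_communityCount i hA hAr (Real.exp_pos _).le, ← ENNReal.ofReal_mul (Real.exp_pos _).le,
    ← Real.exp_add, ← sub_eq_add_neg] at h1
  refine (measure_mono fun ω hω => ?_).trans h1
  have hω' : (G.communityCount i ω A : ℝ) < x := hω
  simp only [Set.mem_ofPred_eq]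
  rw [← ENNReal.ofReal_pow (Real.exp_pos _).le, ← ENNReal.ofReal_mul (Real.exp_pos _).le,
    ← ENNReal.ofReal_one, ← Real.exp_nat_mul, ← Real.exp_add]
  refine ENNReal.ofReal_le_ofReal (Real.one_le_exp ?_)
  nlinarith

end

/-! ## Asymptotics of the block size -/

theorem sideLength_pow {d : ℕ} (hd : d ≠ 0) (n : ℕ) : sideLength d n ^ d = n := by
  rw [sideLength, one_div, Real.rpow_inv_natCast_pow (Nat.cast_nonneg n) hd]

theorem tendsto_log_natCast_atTop : Tendsto (fun n : ℕ => Real.log n) atTop atTop :=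
  Real.tendsto_log_atTop.comp tendsto_natCast_atTop_atTop

theorem tendsto_div_log_rpow_atTop {d : ℕ} (hd : d ≠ 0) {χ : ℝ} (hχ : 0 < χ) :
    Tendsto (fun n : ℕ => ((n : ℝ) / (χ * Real.log n)) ^ (1 / (d : ℝ))) atTop atTop := by
  have h1 : Tendsto (fun x : ℝ => Real.log x / x) atTop (𝓝[>] 0) := by
    refine tendsto_nhdsWithin_iff.2 ⟨Real.isLittleO_log_id_atTop.tendsto_div_nhds_zero, ?_⟩
    filter_upwards [eventually_gt_atTop 1] with x hx
    exact div_pos (Real.log_pos hx) (by linarith)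
  have h2 : Tendsto (fun n : ℕ => (n : ℝ) / (χ * Real.log n)) atTop atTop := by
    refine ((h1.inv_tendsto_nhdsGT_zero.comp tendsto_natCast_atTop_atTop).atTop_div_const hχ).congr
      fun n => ?_
    simp only [Function.comp, Pi.inv_apply, inv_div]
    rw [div_div, mul_comm]
  exact (tendsto_rpow_atTop (by positivity)).comp h2

theorem tendsto_blocksPerSide_atTop {d : ℕ} (hd : d ≠ 0) {χ : ℝ} (hχ : 0 < χ) :
    Tendsto (fun n : ℕ => blocksPerSide d n χ) atTop atTop :=
  tendsto_nat_ceil_atTop.comp (tendsto_div_log_rpow_atTop hd hχ)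

/-- Rounding the number of blocks up is asymptotically harmless, since `⌈x⌉ / x → 1`. -/
theorem tendsto_blockVolume_div_log {d : ℕ} (hd : d ≠ 0) {χ : ℝ} (hχ : 0 < χ) :
    Tendsto (fun n : ℕ => (sideLength d n / blocksPerSide d n χ) ^ d / Real.log n) atTop
      (𝓝 χ) := by
  have hx := tendsto_div_log_rpow_atTop hd hχ
  have h1 := (((tendsto_nat_ceil_div_atTop (R := ℝ)).comp hx).inv₀ one_ne_zero).pow d
  have h2 := h1.mul_const χ
  rw [inv_one, one_pow, one_mul] at h2
  refine h2.congr' ?_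
  filter_upwards [eventually_gt_atTop 1] with n hn
  have hlog : 0 < Real.log n := Real.log_pos (by exact_mod_cast hn)
  simp only [Function.comp, inv_div, div_pow]
  rw [sideLength_pow hd, one_div,
    Real.rpow_inv_natCast_pow (by positivity) hd, blocksPerSide, one_div]
  field_simp

/-- Rounding up only shrinks the blocks, so `c = χ^(1/d)` bounds their relative side without error
term. -/
theorem blockSide_le {d n : ℕ} {χ : ℝ} (hn : 1 < n) (hχ : 0 < χ) :
    sideLength d n / blocksPerSide d n χ ≤ χ ^ (1 / (d : ℝ)) * visRadius d n := by
  have hn0 : (0 : ℝ) < n := by positivity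
  have hlog : 0 < Real.log n := Real.log_pos (by exact_mod_cast hn)
  have hx : 0 < ((n : ℝ) / (χ * Real.log n)) ^ (1 / (d : ℝ)) := by positivity
  have hm : ((n : ℝ) / (χ * Real.log n)) ^ (1 / (d : ℝ)) ≤ blocksPerSide d n χ := Nat.le_ceil _
  have hside : 0 ≤ sideLength d n := Real.rpow_nonneg (Nat.cast_nonneg _) _
  refine (div_le_div_of_nonneg_left hside hx hm).trans (le_of_eq ?_)
  rw [visRadius, ← Real.mul_rpow hχ.le hlog.le, sideLength, ← Real.div_rpow hn0.le (by positivity)]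
  congr 1
  field_simp

/-! ## Connectivity of the visibility graph -/

/-- The block index of a lattice site, by reduction modulo the number of blocks per side. -/
def latticeBlock {d m : ℕ} (hm : 0 < m) (z : Fin d → ℤ) : Fin d → Fin m := fun l =>
  ⟨(z l % m).toNat, by
    have h1 := Int.emod_nonneg (z l) (b := m) (by omega)
    have h2 := Int.emod_lt_of_pos (z l) (b := m) (by omega)
    omega⟩

theorem latticeBlock_val {d m : ℕ} (hm : 0 < m) (z : Fin d → ℤ) (l : Fin d) :
    ((latticeBlock hm z l : ℕ) : ℤ) = z l % m :=
  Int.toNat_of_nonneg (Int.emod_nonneg _ (by omega))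

theorem latticeBlock_natCast {d m : ℕ} (hm : 0 < m) (i : Fin d → Fin m) :
    latticeBlock hm (fun l => ((i l : ℕ) : ℤ)) = i := by
  ext l
  have h := latticeBlock_val hm (fun l => ((i l : ℕ) : ℤ)) l
  have h1 : ((i l : ℕ) : ℤ) % m = (i l : ℕ) := by
    exact_mod_cast Nat.mod_eq_of_lt (i l).isLt
  rw [h1] at h
  exact_mod_cast h

/-- Windows with centres congruent modulo `m` see the same blocks, so `m ^ d` centres suffice in the
union bound. -/
theorem latticeBlock_add {d m : ℕ} (hm : 0 < m) (z k : Fin d → ℤ) :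
    latticeBlock hm ((fun l => ((latticeBlock hm z l : ℕ) : ℤ)) + k) = latticeBlock hm (z + k) := by
  ext l
  have h := latticeBlock_val hm ((fun l => ((latticeBlock hm z l : ℕ) : ℤ)) + k) l
  have h1 : ((fun l => ((latticeBlock hm z l : ℕ) : ℤ)) + k) l % m = (z + k) l % m := by
    simp [latticeBlock_val, Int.emod_add_emod]
  rw [h1, ← latticeBlock_val hm] at h
  exact_mod_cast h

/-- A window with `2L < m` does not wrap onto itself; its sites give distinct, hence disjoint,
blocks. -/
theorem latticeBlock_add_injOn {d m : ℕ} (hm : 0 < m) (z : Fin d → ℤ) {L : ℕ} (hL : 2 * L < m) :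
    Set.InjOn (fun k => latticeBlock hm (z + k))
      (Set.Icc (fun _ => -(L : ℤ)) (fun _ => (L : ℤ))) := by
  intro k hk k' hk' h
  ext l
  have h1 := latticeBlock_val hm (z + k) l
  have h2 := latticeBlock_val hm (z + k') l
  have h0 : latticeBlock hm (z + k) = latticeBlock hm (z + k') := h
  rw [h0, h2] at h1
  have h3 : (k' l - k l) % m = 0 := by
    have h4 := Int.emod_eq_emod_iff_emod_sub_eq_zero.1 h1
    simpa using h4
  have h5 := hk.1 l
  have h6 := hk.2 l
  have h7 := hk'.1 l
  have h8 := hk'.2 l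
  simp only at h5 h6 h7 h8
  have h9 := Int.eq_zero_of_abs_lt_dvd (Int.dvd_of_emod_eq_zero h3) (by rw [abs_lt]; omega)
  omega

section

variable {d n : ℕ} {χ δ c : ℝ}

/-- Lattice paths in the periodic lift of the occupied blocks project to walks on the torus. -/
theorem visibilityGraph_connected (hd : 2 ≤ d) (hc : 0 < c) (hcd : c ^ 2 * (d + 3) ≤ 1)
    (hs : sideLength d n / blocksPerSide d n χ ≤ c * visRadius d n)
    (hR : 0 ≤ visRadius d n) (hm : 0 < blocksPerSide d n χ) {cnt : Set (Fin d → ℝ) → ℕ}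
    {M L : ℕ} (hM : ∀ k ∈ visibleSteps d c, ∀ l, |k l| ≤ M)
    (hL : (visibleSteps d c).card + M ≤ L)
    (hV : ∀ z, (vacantSites {z | δ * Real.log n ≤ (cnt (block d n χ (latticeBlock hm z)) : ℝ)}
      L z).card < (visibleSteps d c).card - 1) :
    (visibilityGraph d n χ δ cnt).Connected := by
  have : Nontrivial (Fin d) := Fin.nontrivial_iff_two_le.2 hd
  set occ := {z : Fin d → ℤ | δ * Real.log n ≤ (cnt (block d n χ (latticeBlock hm z)) : ℝ)}
    with hocc
  obtain ⟨⟨z, hz⟩, hreach⟩ :=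
    latticeReach_of_few_vacant (isStepSet_visibleSteps hc hcd) hM hV hL
  have lift : ∀ x (hx : x ∈ occ) y, LatticeReach (visibleSteps d c) occ x y → ∀ hy : y ∈ occ,
      (visibilityGraph d n χ δ cnt).Reachable ⟨latticeBlock hm x, hx⟩ ⟨latticeBlock hm y, hy⟩ := by
    intro x hx y hxy
    induction hxy with
    | refl => exact fun _ => SimpleGraph.Reachable.refl _
    | @tail y y' _ hst ih =>
      intro hy'
      refine (ih hst.1).trans ?_
      -- A step may project to a single block, which is no edge but needs none. Otherwise the
      -- winding number is the difference of the quotients by `m`.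
      by_cases heq : latticeBlock hm y = latticeBlock hm y'
      · have : (⟨latticeBlock hm y, hst.1⟩ : {i : Fin d → Fin (blocksPerSide d n χ) //
            δ * Real.log n ≤ (cnt (block d n χ i) : ℝ)}) = ⟨latticeBlock hm y', hy'⟩ :=
          Subtype.ext heq
        rw [this]
      · refine SimpleGraph.Adj.reachable ⟨fun h => heq (congrArg Subtype.val h),
          mutuallyVisible_block hc hs hR hst.2.2 fun l =>
            ⟨y l / blocksPerSide d n χ - y' l / blocksPerSide d n χ, ?_⟩⟩
        rw [latticeBlock_val, latticeBlock_val, Pi.sub_apply]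
        have h1 := Int.emod_add_mul_ediv (y l) (blocksPerSide d n χ)
        have h2 := Int.emod_add_mul_ediv (y' l) (blocksPerSide d n χ)
        linarith
  have : Nonempty {i : Fin d → Fin (blocksPerSide d n χ) //
      δ * Real.log n ≤ (cnt (block d n χ i) : ℝ)} := ⟨⟨latticeBlock hm z, hz⟩⟩
  refine SimpleGraph.Connected.mk fun v w => ?_
  have key : ∀ v : {i : Fin d → Fin (blocksPerSide d n χ) //
      δ * Real.log n ≤ (cnt (block d n χ i) : ℝ)}, ∃ x, ∃ hx : x ∈ occ,
      v = ⟨latticeBlock hm x, hx⟩ := by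
    rintro ⟨i, hi⟩
    have e := latticeBlock_natCast hm i
    refine ⟨fun l => ((i l : ℕ) : ℤ), ?_, Subtype.ext e.symm⟩
    rw [hocc, Set.mem_ofPred_eq, e]
    exact hi
  obtain ⟨x, hx, rfl⟩ := key v
  obtain ⟨y, hy, rfl⟩ := key w
  exact lift x hx y (hreach x hx y hy) hy

/-- If the visibility graph is disconnected, then some window contains a large set of vacant
blocks. -/
theorem exists_vacant_of_not_connected (hd : 2 ≤ d) (hc : 0 < c) (hcd : c ^ 2 * (d + 3) ≤ 1)
    (hs : sideLength d n / blocksPerSide d n χ ≤ c * visRadius d n)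
    (hR : 0 ≤ visRadius d n) (hm : 0 < blocksPerSide d n χ) {cnt : Set (Fin d → ℝ) → ℕ}
    {M L : ℕ} (hM : ∀ k ∈ visibleSteps d c, ∀ l, |k l| ≤ M)
    (hL : (visibleSteps d c).card + M ≤ L)
    (hG : ¬ (visibilityGraph d n χ δ cnt).Connected) :
    ∃ i : Fin d → Fin (blocksPerSide d n χ),
      ∃ F ∈ (Finset.Icc (fun _ : Fin d => -(L : ℤ)) (fun _ => (L : ℤ))).powersetCard
        ((visibleSteps d c).card - 1),
      ∀ k ∈ F, (cnt (block d n χ (latticeBlock hm ((fun l => ((i l : ℕ) : ℤ)) + k))) : ℝ) <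
        δ * Real.log n := by
  have h := mt (visibilityGraph_connected hd hc hcd hs hR hm hM hL) hG
  push Not at h
  obtain ⟨z, hz⟩ := h
  -- Keeping exactly `|T| - 1` vacant sites and recentring at the origin makes the choices of `F` a
  -- finite family independent of `n`.
  obtain ⟨F, hF, hFc⟩ := Finset.exists_subset_card_eq hz
  refine ⟨latticeBlock hm z, F.map (Equiv.subRight z).toEmbedding,
    Finset.mem_powersetCard.2 ⟨?_, by rw [Finset.card_map, hFc]⟩, ?_⟩
  · intro k hk
    obtain ⟨y, hy, rfl⟩ := Finset.mem_map.1 hk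
    have h1 := (mem_vacantSites.1 (hF hy)).1
    refine Finset.mem_Icc.2 ⟨fun l => ?_, fun l => ?_⟩ <;> have := h1 l <;> simp <;> omega
  · intro k hk
    obtain ⟨y, hy, rfl⟩ := Finset.mem_map.1 hk
    have h1 := (mem_vacantSites.1 (hF hy)).2
    rw [latticeBlock_add]
    simpa using h1

theorem GraphSample.communityCount_biUnion_le {Ω : Type*} {k : ℕ} (G : GraphSample Ω d k)
    (i : Fin k) (ω : Ω) {ι : Type*} (F : Finset ι) (A : ι → Set (Fin d → ℝ)) :
    G.communityCount i ω (⋃ j ∈ F, A j) ≤ ∑ j ∈ F, G.communityCount i ω (A j) := by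
  classical
  unfold GraphSample.communityCount
  refine le_trans (Finset.card_le_card ?_) Finset.card_biUnion_le
  intro u hu
  simp only [Finset.mem_filter, Set.mem_iUnion, Finset.mem_biUnion] at hu ⊢
  obtain ⟨h1, h2, j, hj, h3⟩ := hu
  exact ⟨j, hj, h1, h2, h3⟩

/-- The union bound over windows and sets of vacant blocks. -/
theorem IsGHCM.not_connected_le {Ω : Type*} [MeasurableSpace Ω] {μ : Measure Ω}
    [IsProbabilityMeasure μ] {θ : GHCMParams 2} {G : GraphSample Ω d 2}
    (hG : IsGHCM μ θ d n G) (hd : 2 ≤ d) (hc : 0 < c) (hcd : c ^ 2 * (d + 3) ≤ 1)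
    (hs : sideLength d n / blocksPerSide d n χ ≤ c * visRadius d n)
    (hR : 0 ≤ visRadius d n) {M L : ℕ} (hM : ∀ k ∈ visibleSteps d c, ∀ l, |k l| ≤ M)
    (hL : (visibleSteps d c).card + M ≤ L) (hLm : 2 * L < blocksPerSide d n χ)
    (hK : 0 < (visibleSteps d c).card - 1) {t : ℝ} (ht : 0 ≤ t) :
    μ {ω | ¬ (G.cstarVisibilityGraph n χ δ ω).Connected} ≤
      ENNReal.ofReal ((blocksPerSide d n χ : ℝ) ^ d *
        (((Finset.Icc (fun _ : Fin d => -(L : ℤ)) (fun _ => (L : ℤ))).powersetCard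
          ((visibleSteps d c).card - 1)).card *
        Real.exp (t * (((visibleSteps d c).card - 1 : ℕ) * (δ * Real.log n)) -
          θ.prior 0 * θ.lam * (((visibleSteps d c).card - 1 : ℕ) *
            (sideLength d n / blocksPerSide d n χ) ^ d) * (1 - Real.exp (-t))))) := by
  classical
  set K := (visibleSteps d c).card - 1 with hKdef
  set W := (Finset.Icc (fun _ : Fin d => -(L : ℤ)) (fun _ => (L : ℤ))).powersetCard K with hW
  set s := sideLength d n / blocksPerSide d n χ with hsdef
  have hs0 : 0 ≤ s := div_nonneg (Real.rpow_nonneg (Nat.cast_nonneg _) _) (Nat.cast_nonneg _)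
  have hm : 0 < blocksPerSide d n χ := by omega
  set B := Real.exp (t * (K * (δ * Real.log n)) -
    θ.prior 0 * θ.lam * (K * s ^ d) * (1 - Real.exp (-t))) with hB
  let blk : (Fin d → Fin (blocksPerSide d n χ)) → (Fin d → ℤ) → Set (Fin d → ℝ) := fun i k =>
    block d n χ (latticeBlock hm ((fun l => ((i l : ℕ) : ℤ)) + k))
  -- The `K` deficits are added up, so one Chernoff bound for the union of the blocks, of volume `K
  -- s ^ d`, replaces independence between blocks.
  have hsub : {ω | ¬ (G.cstarVisibilityGraph n χ δ ω).Connected} ⊆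
      ⋃ i ∈ (Finset.univ : Finset (Fin d → Fin (blocksPerSide d n χ))), ⋃ F ∈ W,
        {ω | (G.communityCount 0 ω (⋃ k ∈ F, blk i k) : ℝ) < K * (δ * Real.log n)} := by
    intro ω hω
    obtain ⟨i, F, hF, hlt⟩ := exists_vacant_of_not_connected hd hc hcd hs hR hm hM hL hω
    refine Set.mem_iUnion₂.2 ⟨i, Finset.mem_univ _, Set.mem_iUnion₂.2 ⟨F, hF, ?_⟩⟩
    have hFc := (Finset.mem_powersetCard.1 hF).2
    have hne : F.Nonempty := Finset.card_pos.1 (by omega)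
    calc (G.communityCount 0 ω (⋃ k ∈ F, blk i k) : ℝ)
        ≤ ∑ k ∈ F, (G.communityCount 0 ω (blk i k) : ℝ) := by
          exact_mod_cast G.communityCount_biUnion_le 0 ω F (blk i)
      _ < ∑ _k ∈ F, δ * Real.log n := Finset.sum_lt_sum_of_nonempty hne hlt
      _ = K * (δ * Real.log n) := by rw [Finset.sum_const, hFc, nsmul_eq_mul]
  have hone : ∀ i, ∀ F ∈ W,
      μ {ω | (G.communityCount 0 ω (⋃ k ∈ F, blk i k) : ℝ) < K * (δ * Real.log n)} ≤
        ENNReal.ofReal B := by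
    intro i F hF
    obtain ⟨hFs, hFc⟩ := Finset.mem_powersetCard.1 hF
    have hmeas : ∀ k ∈ F, MeasurableSet (blk i k) := fun k _ => measurableSet_block _ _ _ _
    have hdisj : (F : Set (Fin d → ℤ)).PairwiseDisjoint (blk i) := by
      intro k hk k' hk' hkk
      refine disjoint_block fun h => hkk ?_
      exact latticeBlock_add_injOn hm _ hLm (by simpa using hFs hk) (by simpa using hFs hk') h
    have hvol : (volume (⋃ k ∈ F, blk i k)).toReal = K * s ^ d := by
      rw [measure_biUnion_finset hdisj hmeas,
        Finset.sum_congr rfl fun k _ => volume_block d n χ _, Finset.sum_const, hFc,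
        nsmul_eq_mul, ENNReal.toReal_mul, ENNReal.toReal_natCast,
        ENNReal.toReal_ofReal (pow_nonneg hs0 d)]
    have := hG.communityCount_lt_le 0 (Finset.measurableSet_biUnion F hmeas)
      (Set.iUnion₂_subset fun k _ => block_subset_region _ _ _ _) ht (K * (δ * Real.log n))
    rwa [hvol] at this
  refine (measure_mono hsub).trans ((measure_biUnion_finset_le _ _).trans ?_)
  calc _ ≤ ∑ _i : Fin d → Fin (blocksPerSide d n χ), (W.card : ℝ≥0∞) * ENNReal.ofReal B := by
        refine Finset.sum_le_sum fun i _ => (measure_biUnion_finset_le _ _).trans ?_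
        refine (Finset.sum_le_sum (hone i)).trans (le_of_eq ?_)
        rw [Finset.sum_const, nsmul_eq_mul]
    _ = _ := by
        rw [Finset.sum_const, nsmul_eq_mul, Finset.card_univ, Fintype.card_fun, Fintype.card_fin,
          Fintype.card_fin, ENNReal.ofReal_mul (by positivity), ENNReal.ofReal_mul (by positivity),
          ENNReal.ofReal_natCast, ENNReal.ofReal_pow (by positivity), ENNReal.ofReal_natCast]
        push_cast
        rfl

end

/-! ## The main theorem -/

/-- As `1 / r > 0`, the volume condition forces `ρ ^ d > 1/2`, hence `ρ ^ 2 > 1/2` and `ρ > 7/10`.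
This means `√d c < 1/5`, and `d + 3 ≤ 5d/2` for `d ≥ 2`. -/
theorem ChiCondition.sq_mul_le {d : ℕ} (hd : 2 ≤ d) {r χ : ℝ} (hr : 0 < r)
    (hχ : ChiCondition d r χ) : (χ ^ (1 / (d : ℝ))) ^ 2 * (d + 3) ≤ 1 := by
  have hν : 0 < 1 / r := by positivity
  have hlt := hχ.lt
  have hpos := hχ.pos
  have hvol := hχ.volume_cond
  have hρ := hχ.radius_pos
  set c := χ ^ (1 / (d : ℝ)) with hc
  have hc0 : 0 < c := Real.rpow_pos_of_pos hpos _
  set ρ := 1 - 3 * Real.sqrt d * c / 2 with hρd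
  have hρ1 : ρ ≤ 1 := by
    have : 0 ≤ 3 * Real.sqrt d * c / 2 := by positivity
    linarith
  have h1 : ρ ^ d ≤ ρ ^ 2 := pow_le_pow_of_le_one hρ.le hρ1 hd
  have hν0 : 0 < unitBallVolume d := by linarith
  have h2 : 1 / 2 < ρ ^ d := by
    by_contra! h
    nlinarith
  have h3 : (7 : ℝ) / 10 < ρ := by nlinarith
  have h4 : Real.sqrt d * c < 1 / 5 := by linarith
  have h5 : (Real.sqrt d * c) ^ 2 < (1 / 5) ^ 2 := pow_lt_pow_left₀ h4 (by positivity) two_ne_zero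
  rw [mul_pow, Real.sq_sqrt (Nat.cast_nonneg d)] at h5
  have h6 : (2 : ℝ) ≤ d := by exact_mod_cast hd
  nlinarith [mul_le_mul_of_nonneg_right h6 (sq_nonneg c)]

/-- Subtracting `χ < (ν_d - 1/r)/2` from `χ|T| ≥ (ν_d + 1/r)/2` leaves `χ(|T| - 1) > 1/r`. -/
theorem ChiCondition.one_lt {d : ℕ} (hd : d ≠ 0) {r χ : ℝ} (hr : 0 < r)
    (hχ : ChiCondition d r χ) :
    1 < r * χ * ((visibleSteps d (χ ^ (1 / (d : ℝ)))).card - 1 : ℕ) := by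
  have hc0 : 0 < χ ^ (1 / (d : ℝ)) := Real.rpow_pos_of_pos hχ.pos _
  have h := unitBallVolume_mul_le hc0 hχ.radius_pos
  rw [one_div, Real.rpow_inv_natCast_pow hχ.pos.le hd, ← one_div] at h
  have hvol := hχ.volume_cond
  have hlt := hχ.lt
  have h1 : 1 / r < χ * ((visibleSteps d (χ ^ (1 / (d : ℝ)))).card - 1) := by linarith
  have h2 : ((visibleSteps d (χ ^ (1 / (d : ℝ)))).card : ℝ) - 1 ≤
      ((visibleSteps d (χ ^ (1 / (d : ℝ)))).card - 1 : ℕ) := by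
    have : (visibleSteps d (χ ^ (1 / (d : ℝ)))).card ≤
      ((visibleSteps d (χ ^ (1 / (d : ℝ)))).card - 1) + 1 := by omega
    have h3 : ((visibleSteps d (χ ^ (1 / (d : ℝ)))).card : ℝ) ≤
      ((visibleSteps d (χ ^ (1 / (d : ℝ)))).card - 1 : ℕ) + 1 := by exact_mod_cast this
    linarith
  have h3 := h1.trans_le (mul_le_mul_of_nonneg_left h2 hχ.pos.le)
  rw [div_lt_iff₀ hr] at h3
  linarith

theorem mainTheorem2 (d : ℕ) (hd : 2 ≤ d) (r χ : ℝ) (hr : 0 < r) (hχ : ChiCondition d r χ) :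
    ∃ δt : ℝ, 0 < δt ∧
      ∀ θ : GHCMParams 2, θ.prior 0 * θ.lam = r →
        θ.obsLaw 0 0 ≠ θ.obsLaw 0 1 → θ.obsLaw 1 0 = θ.obsLaw 1 1 →
        1 < θ.lam * unitBallVolume d * θ.minDivergence →
      ∀ δ : ℝ, 0 < δ → δ < δt * χ / (unitBallVolume d * radiusConst d χ) →
      ∀ (Ω : ℕ → Type*) [∀ n, MeasurableSpace (Ω n)] (μ : ∀ n, Measure (Ω n))
        [∀ n, IsProbabilityMeasure (μ n)] (G : ∀ n, GraphSample (Ω n) d 2),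
        (∀ n, IsGHCM (μ n) θ d n (G n)) →
        Tendsto (fun n => μ n {ω | ((G n).cstarVisibilityGraph n χ δ ω).Connected})
          atTop (𝓝 1) := by
  have hd0 : d ≠ 0 := by omega
  have hχ0 := hχ.pos
  set c := χ ^ (1 / (d : ℝ)) with hc
  have hc0 : 0 < c := Real.rpow_pos_of_pos hχ0 _
  have hcd : c ^ 2 * (d + 3) ≤ 1 := hχ.sq_mul_le hd hr
  set K := (visibleSteps d c).card - 1 with hK
  have hrK : 1 < r * χ * (K : ℝ) := hχ.one_lt hd0 hr
  set a := r * χ * (K : ℝ) with ha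
  have hK0 : 0 < K := Nat.pos_of_ne_zero fun h => by rw [ha, h] at hrK; norm_num at hrK
  have hKr : (0 : ℝ) < K := by exact_mod_cast hK0
  have hinv1 : 1 / a < 1 := by rw [div_lt_one (by linarith)]; exact hrK
  -- Taking `exp (-t) = (1 - 1/a)/2` puts the Chernoff exponent at the midpoint of `1` and `a`.
  obtain ⟨t, ht, hta⟩ : ∃ t : ℝ, 0 < t ∧ a * (1 - Real.exp (-t)) = (a + 1) / 2 := by
    have hq : 0 < (1 - 1 / a) / 2 := by linarith
    have hq1 : (1 - 1 / a) / 2 < 1 := by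
      have : 0 < 1 / a := by positivity
      linarith
    refine ⟨-Real.log ((1 - 1 / a) / 2), neg_pos.2 (Real.log_neg hq hq1), ?_⟩
    rw [neg_neg, Real.exp_log hq]
    field_simp
    ring
  have hν : 0 < unitBallVolume d := by
    have : 0 < 1 / r := by positivity
    linarith [hχ.lt]
  have hRd : 0 < radiusConst d χ := by
    have h1 := hχ.radius_pos
    have h2 : 0 ≤ Real.sqrt d * c := by positivity
    unfold radiusConst
    linarith
  -- Chosen so that the condition on `δ` reads `δ < (a - 1)/(4tK)`, that is, `tKδ < (a - 1)/4`.
  refine ⟨(a - 1) / (4 * (t * K)) * (unitBallVolume d * radiusConst d χ) / χ, ?_, ?_⟩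
  · have : 0 < a - 1 := by linarith
    positivity
  intro θ hθ _ _ _ δ hδ hδt Ω _ μ _ G hG
  rw [div_mul_cancel₀ _ hχ0.ne', mul_div_cancel_right₀ _ (by positivity),
    lt_div_iff₀ (by positivity)] at hδt
  obtain ⟨M, hM⟩ : ∃ M : ℕ, ∀ k ∈ visibleSteps d c, ∀ l, |k l| ≤ M := by
    refine ⟨∑ k ∈ visibleSteps d c, ∑ l, (k l).natAbs, fun k hk l => ?_⟩
    rw [Int.abs_eq_natAbs]
    have h1 := Finset.single_le_sum (f := fun l => (k l).natAbs) (fun _ _ => Nat.zero_le _)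
      (Finset.mem_univ l)
    have h2 := Finset.single_le_sum (f := fun k : Fin d → ℤ => ∑ l, (k l).natAbs)
      (fun _ _ => Nat.zero_le _) hk
    exact_mod_cast h1.trans h2
  set L := (visibleSteps d c).card + M with hL
  set C : ℝ :=
    ((((Finset.Icc (fun _ : Fin d => -(L : ℤ)) (fun _ => (L : ℤ))).powersetCard K).card : ℕ) : ℝ)
    with hC
  set η := (a - 1) / 8 with hη
  have hη0 : 0 < η := by rw [hη]; linarith
  have hvol := tendsto_blockVolume_div_log hd0 hχ0
  have hexp : Tendsto (fun n : ℕ => 1 + t * K * δ - r * K * (1 - Real.exp (-t)) *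
      ((sideLength d n / blocksPerSide d n χ) ^ d / Real.log n)) atTop
      (𝓝 (1 + t * K * δ - r * K * (1 - Real.exp (-t)) * χ)) :=
    tendsto_const_nhds.sub (hvol.const_mul _)
  -- Per unit of `log n`: `1` for the windows, `tKδ` for the threshold, minus `(a + 1)/2` for the
  -- mean. The total is below `-(a - 1)/4 < -η`.
  have hlim : 1 + t * K * δ - r * K * (1 - Real.exp (-t)) * χ < -η := by
    have h1 : r * K * (1 - Real.exp (-t)) * χ = (a + 1) / 2 := by rw [← hta, ha]; ring
    rw [h1, hη]
    linarith
  have hbad : ∀ᶠ n : ℕ in atTop,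
      μ n {ω | ¬ ((G n).cstarVisibilityGraph n χ δ ω).Connected} ≤
        ENNReal.ofReal (C * Real.exp (-(η * Real.log n))) := by
    filter_upwards [eventually_gt_atTop 1, hexp.eventually_lt_const hlim,
      (tendsto_blocksPerSide_atTop hd0 hχ0).eventually_gt_atTop (2 * L),
      hvol.eventually_const_lt (show χ / 2 < χ by linarith),
      tendsto_log_natCast_atTop.eventually_ge_atTop (2 / χ)] with n hn hlt hm hv hlogn
    have hlog : 0 < Real.log n := Real.log_pos (by exact_mod_cast hn)
    have hn0 : (0 : ℝ) < n := by positivity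
    have hm0 : (0 : ℝ) < blocksPerSide d n χ := by
      have : 0 < blocksPerSide d n χ := by omega
      exact_mod_cast this
    refine ((hG n).not_connected_le hd hc0 hcd (blockSide_le hn hχ0)
      (Real.rpow_nonneg hlog.le _) hM le_rfl hm hK0 ht.le).trans (ENNReal.ofReal_le_ofReal ?_)
    -- Blocks eventually have volume at least `(χ/2) log n ≥ 1`, so there are at most `n` of them.
    have hmd : (blocksPerSide d n χ : ℝ) ^ d ≤ Real.exp (Real.log n) := by
      rw [Real.exp_log hn0]
      rw [lt_div_iff₀ hlog, div_pow, sideLength_pow hd0] at hv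
      rw [div_le_iff₀ hχ0] at hlogn
      have h1 : 1 ≤ (n : ℝ) / (blocksPerSide d n χ : ℝ) ^ d := by linarith
      rwa [one_le_div (by positivity)] at h1
    rw [hθ]
    refine (mul_le_mul_of_nonneg_right hmd (by positivity)).trans (le_of_eq_of_le
      (mul_left_comm _ _ _) (mul_le_mul_of_nonneg_left ?_ (Nat.cast_nonneg _)))
    rw [← Real.exp_add]
    refine Real.exp_le_exp.2 ?_
    have h2 := mul_le_mul_of_nonneg_right hlt.le hlog.le
    have h3 : (sideLength d n / blocksPerSide d n χ) ^ d =
        (sideLength d n / blocksPerSide d n χ) ^ d / Real.log n * Real.log n := by field_simp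
    rw [h3]
    linarith
  have hzero : Tendsto (fun n : ℕ => ENNReal.ofReal (C * Real.exp (-(η * Real.log n)))) atTop
      (𝓝 0) := by
    have h1 := (Real.tendsto_exp_neg_atTop_nhds_zero.comp
      (tendsto_log_natCast_atTop.const_mul_atTop hη0)).const_mul C
    rw [mul_zero] at h1
    simpa using ENNReal.tendsto_ofReal h1
  have hsub : Tendsto (fun n : ℕ => 1 - ENNReal.ofReal (C * Real.exp (-(η * Real.log n)))) atTop
      (𝓝 1) := by
    simpa using ENNReal.Tendsto.sub tendsto_const_nhds hzero (Or.inl ENNReal.one_ne_top)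
  refine tendsto_of_tendsto_of_tendsto_of_le_of_le' hsub tendsto_const_nhds ?_
    (Eventually.of_forall fun n => prob_le_one)
  filter_upwards [hbad] with n hn
  -- Subadditivity over the event and its complement suffices, so measurability of connectivity is
  -- not needed.
  refine tsub_le_iff_right.2 (le_trans ?_ (add_le_add_right hn _))
  refine le_trans (le_of_eq ?_) (measure_union_le _ _)
  rw [← measure_univ (μ := μ n)]
  congr 1
  ext ω
  simpa using em _
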